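/- All graphs are finite and simple. A graph is \emph{2-connected} if it is connected and remains connected (or becomes empty) after the deletion of any one vertex; a \emph{block} of a graph is a maximal 2-connected subgraph (so $K_1$ and $K_2$ may occur as blocks), and a \emph{block graph} is a (not necessarily connected) graph all of whose blocks are complete graphs. A \emph{magic unitary} with coefficients in a unital $*$-algebra $X$ is a matrix $U=(u_{ij})_{i\in I,j\in J}$ over $X$, with $I,J$ finite, such that $u_{ij}^2=u_{ij}=u_{ij}^*$, $u_{ij}u_{ik}=0$ for $j\neq k$, $u_{ij}u_{kj}=0$ for $i\neq k$, and $\sum_{j}u_{ij}=1=\sum_{i}u_{ij}$. A graph $G$ is \emph{quantum isomorphic} to a graph $H$ if there is a magic unitary $U$ indexed by $V(H)\times V(G)$ with coefficients in a nonzero unital $C^*$-algebra such that $U\,\mathrm{Adj}(G)=\mathrm{Adj}(H)\,U$. A graph $G$ has \emph{quantum symmetry} if the underlying algebra of its quantum automorphism group, that is, the universal unital complex $*$-algebra generated by the entries of a magic unitary indexed by $V(G)\times V(G)$ and commuting with $\mathrm{Adj}(G)$, is not commutative. \textbf{Theorem.} Block graphs form a superrigid tractable hereditary class of graphs. That is,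 every induced subgraph of a block graph is a block graph, and for every block graph $G$: \begin{itemize} \item (SR) every graph $H$ that is quantum isomorphic to $G$ is isomorphic to $G$; \item (SA) $G$ has quantum symmetry if and only if $G$ has two nontrivial automorphisms with disjoint supports. \end{itemize} -/

import Mathlib

universe u v w

noncomputable section

/-! ### Block graphs -/

namespace SimpleGraph

/-- A graph is 2-connected if it is connected and stays connected (possibly becoming empty)
after the removal of any one vertex. In particular `K₁` and `K₂` are 2-connected. -/
def IsTwoConnected {V : Type u} (G : SimpleGraph V) : Prop :=
  G.Connected ∧ ∀ v : V, (G.induce {v}ᶜ).Preconnected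

/-- A block of `G` is a maximal 2-connected subgraph of `G`. -/
def IsBlock {V : Type u} (G : SimpleGraph V) (B : G.Subgraph) : Prop :=
  Maximal (fun C : G.Subgraph => C.coe.IsTwoConnected) B

/-- A block graph is a graph all of whose blocks are complete graphs. -/
def IsBlockGraph {V : Type u} (G : SimpleGraph V) : Prop :=
  ∀ B : G.Subgraph, G.IsBlock B → B.coe = ⊤

/-- Schmidt's criterion: there are two nontrivial automorphisms with disjoint supports. -/
def SchmidtCriterion {V : Type u} (G : SimpleGraph V) : Prop :=
  ∃ σ τ : G ≃g G, (∃ v, σ v ≠ v) ∧ (∃ v, τ v ≠ v) ∧ Disjoint {v | σ v ≠ v} {v | τ v ≠ v}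

end SimpleGraph

/-! ### Magic unitaries and quantum isomorphism -/

/-- A magic unitary with coefficients in a unital `*`-algebra. -/
structure IsMagicUnitary {I : Type u} {J : Type v} [Fintype I] [Fintype J]
    {X : Type w} [Ring X] [StarRing X] (U : Matrix I J X) : Prop where
  isSelfAdjoint : ∀ i j, star (U i j) = U i j
  idem : ∀ i j, U i j * U i j = U i j
  row_orthogonal : ∀ i j k, j ≠ k → U i j * U i k = 0
  col_orthogonal : ∀ i j k, i ≠ k → U i j * U k j = 0
  sum_row : ∀ i, ∑ j, U i j = 1
  sum_col : ∀ j, ∑ i, U i j = 1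

open Classical in
/-- The relation `U Adj(G) = Adj(H) U`, where the rows of `U` are indexed by the vertices of `H`
and its columns by the vertices of `G`. -/
def Intertwines {V : Type u} {W : Type v} [Fintype V] [Fintype W] {X : Type w} [Ring X]
    (G : SimpleGraph V) (H : SimpleGraph W) (U : Matrix W V X) : Prop :=
  U * G.adjMatrix X = H.adjMatrix X * U

/-- There is a quantum isomorphism from `G` to `H`: a magic unitary with coefficients in a nonzero
unital C*-algebra that intertwines the adjacency matrices. -/
def QuantumIsomorphic {V : Type u} {W : Type v} [Fintype V] [Fintype W]
    (G : SimpleGraph V) (H : SimpleGraph W) : Prop :=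
  ∃ (X : Type w) (_ : CStarAlgebra X) (_ : Nontrivial X) (U : Matrix W V X),
    IsMagicUnitary U ∧ Intertwines G H U

/-! ### The free unital complex `*`-algebra on a set of generators -/

/-- The free unital complex `*`-algebra on a type `S`: noncommutative polynomials over `ℂ` in the
generators `s` (left copy of `S`) and their formal adjoints `s*` (right copy of `S`). -/
def FreeStarAlgebra (S : Type u) : Type u := FreeAlgebra ℂ (S ⊕ S)

namespace FreeStarAlgebra

variable {S : Type u}

instance : Ring (FreeStarAlgebra S) := inferInstanceAs (Ring (FreeAlgebra ℂ (S ⊕ S)))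

instance : Algebra ℂ (FreeStarAlgebra S) := inferInstanceAs (Algebra ℂ (FreeAlgebra ℂ (S ⊕ S)))

/-- The generators together with their formal adjoints. -/
def ι (x : S ⊕ S) : FreeStarAlgebra S := FreeAlgebra.ι ℂ x

/-- The generator attached to `s : S`. -/
def of (s : S) : FreeStarAlgebra S := ι (Sum.inl s)

/-- The involution as a ring homomorphism to the opposite ring: conjugate-linear, and exchanging
each generator with its formal adjoint. -/
def starHom (S : Type u) : FreeStarAlgebra S →+* (FreeStarAlgebra S)ᵐᵒᵖ :=
  letI : Algebra ℂ (FreeStarAlgebra S)ᵐᵒᵖ :=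
    Algebra.compHom (FreeStarAlgebra S)ᵐᵒᵖ (starRingEnd ℂ)
  (FreeAlgebra.lift ℂ fun x : S ⊕ S =>
    (MulOpposite.op (ι x.swap) : (FreeStarAlgebra S)ᵐᵒᵖ)).toRingHom

theorem starHom_ι (x : S ⊕ S) :
    starHom S (ι x) = MulOpposite.op (ι x.swap) := by
  let _ : Algebra ℂ (FreeStarAlgebra S)ᵐᵒᵖ :=
    Algebra.compHom (FreeStarAlgebra S)ᵐᵒᵖ (starRingEnd ℂ)
  exact FreeAlgebra.lift_ι_apply (R := ℂ) (A := (FreeStarAlgebra S)ᵐᵒᵖ) _ x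

theorem starHom_algebraMap (c : ℂ) :
    starHom S (algebraMap ℂ (FreeStarAlgebra S) c)
      = MulOpposite.op (algebraMap ℂ (FreeStarAlgebra S) (star c)) := by
  let _ : Algebra ℂ (FreeStarAlgebra S)ᵐᵒᵖ :=
    Algebra.compHom (FreeStarAlgebra S)ᵐᵒᵖ (starRingEnd ℂ)
  exact AlgHom.commutes (FreeAlgebra.lift ℂ fun x : S ⊕ S =>
    (MulOpposite.op (ι x.swap) : (FreeStarAlgebra S)ᵐᵒᵖ)) c

theorem induction {p : FreeStarAlgebra S → Prop}
    (h_scalar : ∀ c : ℂ, p (algebraMap ℂ (FreeStarAlgebra S) c))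
    (h_gen : ∀ x : S ⊕ S, p (ι x))
    (h_mul : ∀ a b, p a → p b → p (a * b)) (h_add : ∀ a b, p a → p b → p (a + b))
    (a : FreeStarAlgebra S) : p a :=
  FreeAlgebra.induction ℂ (S ⊕ S) (motive := p) h_scalar h_gen h_mul h_add a

instance : StarRing (FreeStarAlgebra S) where
  star a := (starHom S a).unop
  star_involutive a := by
    change (starHom S (starHom S a).unop).unop = a
    induction a using FreeStarAlgebra.induction with
    | h_scalar c => simp [starHom_algebraMap]
    | h_gen x => simp [starHom_ι]
    | h_mul a b ha hb => simp [ha, hb]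
    | h_add a b ha hb => simp [ha, hb]
  star_mul a b := by
    change (starHom S (a * b)).unop = (starHom S b).unop * (starHom S a).unop
    simp
  star_add a b := by
    change (starHom S (a + b)).unop = (starHom S a).unop + (starHom S b).unop
    simp

theorem star_ι (x : S ⊕ S) :
    star (ι x : FreeStarAlgebra S) = ι x.swap := by
  change (starHom S (ι x)).unop = _
  simp [starHom_ι]

theorem star_algebraMap (c : ℂ) :
    star (algebraMap ℂ (FreeStarAlgebra S) c) = algebraMap ℂ (FreeStarAlgebra S) (star c) := by
  change (starHom S (algebraMap ℂ (FreeStarAlgebra S) c)).unop = _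
  simp [starHom_algebraMap]

instance : StarModule ℂ (FreeStarAlgebra S) where
  star_smul c a := by
    rw [Algebra.smul_def, star_mul, star_algebraMap, Algebra.smul_def, Algebra.commutes]

end FreeStarAlgebra

/-! ### The quantum automorphism group of a graph -/

namespace QuantumAut

variable {V : Type u} [Fintype V]

/-- The matrix of free generators. -/
def freeMatrix (V : Type u) : Matrix V V (FreeStarAlgebra (V × V)) :=
  fun x y => FreeStarAlgebra.of (x, y)

open Classical in
/-- The defining relations: the matrix of generators is a magic unitary that commutes with the
adjacency matrix of `G`. The last constructor closes the relations under the involution. -/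
inductive Rel (G : SimpleGraph V) :
    FreeStarAlgebra (V × V) → FreeStarAlgebra (V × V) → Prop
  | isSelfAdjoint (x y : V) : Rel G (star (freeMatrix V x y)) (freeMatrix V x y)
  | idem (x y : V) : Rel G (freeMatrix V x y * freeMatrix V x y) (freeMatrix V x y)
  | row_orthogonal (x y z : V) (h : y ≠ z) : Rel G (freeMatrix V x y * freeMatrix V x z) 0
  | col_orthogonal (x y z : V) (h : x ≠ z) : Rel G (freeMatrix V x y * freeMatrix V z y) 0
  | sum_row (x : V) : Rel G (∑ y, freeMatrix V x y) 1
  | sum_col (y : V) : Rel G (∑ x, freeMatrix V x y) 1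
  | adj (x y : V) : Rel G ((freeMatrix V * G.adjMatrix (FreeStarAlgebra (V × V))) x y)
      ((G.adjMatrix (FreeStarAlgebra (V × V)) * freeMatrix V) x y)
  | star_closed (a b : FreeStarAlgebra (V × V)) (h : Rel G a b) : Rel G (star a) (star b)

/-- The universal unital `*`-algebra generated by the entries of a magic unitary indexed by
`V × V` that commutes with the adjacency matrix of `G`. -/
def A (G : SimpleGraph V) : Type u := RingQuot (Rel G)

variable (G : SimpleGraph V)

instance : Ring (A G) := inferInstanceAs (Ring (RingQuot (Rel G)))

instance : Algebra ℂ (A G) := inferInstanceAs (Algebra ℂ (RingQuot (Rel G)))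

instance : StarRing (A G) := RingQuot.starRing (Rel G) Rel.star_closed

/-- The quotient map from the free `*`-algebra. -/
def mk : FreeStarAlgebra (V × V) →ₐ[ℂ] A G := RingQuot.mkAlgHom ℂ (Rel G)

/-- The fundamental representation of the quantum automorphism group of `G`. -/
def U : Matrix V V (A G) := fun x y => mk G (freeMatrix V x y)

theorem mk_surjective : Function.Surjective (mk G) := RingQuot.mkAlgHom_surjective ℂ (Rel G)

theorem mk_star (a : FreeStarAlgebra (V × V)) : mk G (star a) = star (mk G a) := by
  have h : ∀ b, mk G b = (⟨Quot.mk _ b⟩ : RingQuot (Rel G)) := fun b => by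
    simp only [mk, RingQuot.mkAlgHom_def, RingQuot.mkRingHom_def]; rfl
  rw [h, h]; rfl

theorem mk_rel {a b : FreeStarAlgebra (V × V)} (h : Rel G a b) : mk G a = mk G b :=
  RingQuot.mkAlgHom_rel ℂ h

instance : StarModule ℂ (A G) where
  star_smul c a := by
    obtain ⟨a, rfl⟩ := mk_surjective G a
    rw [← map_smul, ← mk_star, star_smul, map_smul, mk_star]

theorem isMagicUnitary_U : IsMagicUnitary (U G) where
  isSelfAdjoint x y := by
    rw [U, ← mk_star]; exact mk_rel G (.isSelfAdjoint x y)
  idem x y := by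
    rw [U, ← map_mul]; exact mk_rel G (.idem x y)
  row_orthogonal x y z h := by
    simp only [U]; rw [← map_mul, mk_rel G (.row_orthogonal x y z h), map_zero]
  col_orthogonal x y z h := by
    simp only [U]; rw [← map_mul, mk_rel G (.col_orthogonal x y z h), map_zero]
  sum_row x := by
    simp only [U]; rw [← map_sum, mk_rel G (.sum_row x), map_one]
  sum_col y := by
    simp only [U]; rw [← map_sum, mk_rel G (.sum_col y), map_one]

theorem intertwines_U : Intertwines G G (U G) := by
  classical
  ext x y
  have h := mk_rel G (.adj x y)
  simp only [Matrix.mul_apply, SimpleGraph.adjMatrix_apply, map_sum, map_mul, apply_ite (mk G),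
    map_one, map_zero] at h ⊢
  exact h

/-- The universal property of `A G` with its fundamental representation `U G`. -/
theorem existsUnique_lift {X : Type w} [Ring X] [StarRing X] [Algebra ℂ X] [StarModule ℂ X]
    (T : Matrix V V X) (hT : IsMagicUnitary T) (hG : Intertwines G G T) :
    ∃! φ : A G →⋆ₐ[ℂ] X, ∀ x y, φ (U G x y) = T x y := by
  classical
  let f : FreeStarAlgebra (V × V) →ₐ[ℂ] X :=
    FreeAlgebra.lift ℂ (Sum.elim (fun p => T p.1 p.2) (fun p => star (T p.1 p.2)))
  have hf : ∀ x y, f (freeMatrix V x y) = T x y := fun x y => by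
    exact FreeAlgebra.lift_ι_apply (R := ℂ) _ _
  have hι : ∀ p : (V × V) ⊕ (V × V), f (FreeStarAlgebra.ι p)
      = Sum.elim (fun p => T p.1 p.2) (fun p => star (T p.1 p.2)) p := fun p =>
    FreeAlgebra.lift_ι_apply (R := ℂ) _ _
  have hstar : ∀ a, f (star a) = star (f a) := fun a => by
    induction a using FreeStarAlgebra.induction with
    | h_scalar c =>
      rw [FreeStarAlgebra.star_algebraMap, AlgHom.commutes, AlgHom.commutes, algebraMap_star_comm]
    | h_gen p => rw [FreeStarAlgebra.star_ι, hι, hι]; cases p <;> simp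
    | h_mul a b ha hb => simp [ha, hb]
    | h_add a b ha hb => simp [ha, hb]
  have hrel : ∀ ⦃a b⦄, Rel G a b → f a = f b := fun a b h => by
    induction h with
    | isSelfAdjoint x y => rw [hstar, hf, hT.isSelfAdjoint]
    | idem x y => rw [map_mul, hf, hT.idem]
    | row_orthogonal x y z h => rw [map_mul, hf, hf, hT.row_orthogonal x y z h, map_zero]
    | col_orthogonal x y z h => rw [map_mul, hf, hf, hT.col_orthogonal x y z h, map_zero]
    | sum_row x => simp only [map_sum, hf, hT.sum_row, map_one]
    | sum_col y => simp only [map_sum, hf, hT.sum_col, map_one]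
    | adj x y =>
      have h := congrFun (congrFun hG x) y
      simp only [Matrix.mul_apply, SimpleGraph.adjMatrix_apply, map_sum, map_mul, apply_ite f,
        map_one, map_zero, hf] at h ⊢
      exact h
    | star_closed a b _ ih => rw [hstar, hstar, ih]
  let g : A G →ₐ[ℂ] X := RingQuot.liftAlgHom ℂ ⟨f, hrel⟩
  have hg : ∀ a, g (mk G a) = f a := fun a => RingQuot.liftAlgHom_mkAlgHom_apply ℂ f hrel a
  refine ⟨{ g with map_star' := fun a => ?_ }, fun x y => (hg _).trans (hf x y), fun φ hφ => ?_⟩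
  · obtain ⟨a, rfl⟩ := mk_surjective G a
    change g (star (mk G a)) = star (g (mk G a))
    rw [← mk_star, hg, hg, hstar]
  · have key : ∀ a, φ (mk G a) = f a := fun a => by
      induction a using FreeStarAlgebra.induction with
      | h_scalar c => rw [AlgHom.commutes, AlgHom.commutes, AlgHomClass.commutes]
      | h_gen p =>
        rw [hι]
        rcases p with p | p
        · exact hφ p.1 p.2
        · have := FreeStarAlgebra.star_ι (Sum.inl p)
          rw [Sum.swap_inl] at this
          rw [← this, mk_star, map_star]
          exact congrArg star (hφ p.1 p.2)
      | h_mul a b ha hb => simp only [map_mul, ha, hb]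
      | h_add a b ha hb => simp only [map_add, ha, hb]
    ext a
    obtain ⟨a, rfl⟩ := mk_surjective G a
    exact (key a).trans (hg a).symm

end QuantumAut

/-- A graph has quantum symmetry if the underlying algebra of its quantum automorphism group is
not commutative. -/
def HasQuantumSymmetry {V : Type u} [Fintype V] (G : SimpleGraph V) : Prop :=
  ¬ ∀ a b : QuantumAut.A G, a * b = b * a

end

/-! A finite graph is a block graph exactly when two neighbours of a vertex that are joined by a
walk avoiding it are adjacent (`IsNeighborSeparating`). This condition is visibly hereditary, and it
controls distances: towards a fixed target, each clique has at most one gate.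

Such a graph has a canonical rooted structure. Orient an edge towards its end that is closer to more
than half of the component. Each vertex gets at most one parent, the unoriented edges form disjoint
cliques of siblings, and siblings share their parent (`IsCentroidRooted`). Adding a root and one
node per sibling class turns the graph into a rooted tree that determines it.

Parents and siblings are defined by counting in terms of distances, and magic unitaries respect such
counts: if `U x a * U y b ≠ 0`, then `(x, y)` and `(a, b)` satisfy the same relations
(`Compatible.sum`). So a graph `H` quantum isomorphic to `G` is centroid rooted as well, and `U`
extends to a magic unitary between the trees that respects parent functions
(`isTreeMagic_nodeMatrix`). Counting children by isomorphism type shows that a nonzero entry joins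
nodes with isomorphic subtrees (`IsTreeMagic.type_eq`). Applied to the roots, this gives `H ≃g G`.

For quantum symmetry, noncommuting entries at two nodes whose paths diverge at some node force two
pairs of isomorphic sibling subtrees with disjoint supports (`commute_of_distinct_children`), the
only delicate case being three siblings of one type. Swapping each pair gives two disjoint
automorphisms. Conversely, in any graph two disjoint automorphisms can be switched on and off
independently by two noncommuting projections. -/

namespace SimpleGraph

/-! ### Block graphs in terms of walks -/

variable {V : Type u} {G : SimpleGraph V}

/-- Two neighbours of a vertex that are joined by a walk avoiding that vertex are adjacent. -/
def IsNeighborSeparating (G : SimpleGraph V) : Prop :=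
  ∀ ⦃v w w' : V⦄, G.Adj v w → G.Adj v w' → w ≠ w' →
    ∀ p : G.Walk w w', v ∉ p.support → G.Adj w w'

/-- Pulls walks of `G` back to nested subtypes such as `B.coe` with a vertex deleted; there `f` is
the composite coercion. -/
theorem reachable_of_walk_of_range {κ : Type*} {K : SimpleGraph κ} (f : κ → V)
    (hf : Function.Injective f) (hadj : ∀ a b, G.Adj (f a) (f b) → K.Adj a b) {x y : V}
    (p : G.Walk x y) (hp : ∀ z ∈ p.support, z ∈ Set.range f) :
    ∀ a b, f a = x → f b = y → K.Reachable a b := by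
  induction p with
  | nil =>
    rintro a b rfl h
    rw [hf h]
  | @cons x y z h p ih =>
    rintro a b rfl rfl
    obtain ⟨c, rfl⟩ := hp y (by simp)
    exact (hadj _ _ h).reachable.trans
      (ih (fun z hz => hp z (by simp [hz])) c b rfl rfl)

theorem Walk.IsPath.notMem_support_dropUntil [DecidableEq V] {x y s z : V} {p : G.Walk x y}
    (hp : p.IsPath) (hs : s ∈ p.support) (hz : z ∈ (p.takeUntil s hs).support) (hne : z ≠ s) :
    z ∉ (p.dropUntil s hs).support := by
  intro hz'
  have h := hp.support_nodup
  rw [← p.take_spec hs, Walk.support_append, List.nodup_append] at h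
  rw [Walk.mem_support_iff] at hz'
  exact h.2.2 _ hz _ (hz'.resolve_left hne) rfl

theorem isTwoConnected_of_walks (B : G.Subgraph) (hB : ∀ x ∈ B.verts, ∀ y ∈ B.verts, G.Adj x y → B.Adj x y)
    (hne : B.verts.Nonempty)
    (h : ∀ z, ∀ x ∈ B.verts, ∀ y ∈ B.verts, x ≠ z → y ≠ z →
      ∃ p : G.Walk x y, ∀ s ∈ p.support, s ∈ B.verts ∧ s ≠ z)
    (hc : ∀ x ∈ B.verts, ∀ y ∈ B.verts, ∃ p : G.Walk x y, ∀ s ∈ p.support, s ∈ B.verts) :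
    B.coe.IsTwoConnected := by
  have hadj : ∀ x y : B.verts, G.Adj x y → B.coe.Adj x y := fun x y => hB x x.2 y y.2
  refine ⟨?_, fun v => ?_⟩
  · have : Nonempty B.verts := hne.to_subtype
    refine ⟨fun x y => ?_⟩
    obtain ⟨p, hp⟩ := hc x x.2 y y.2
    exact reachable_of_walk_of_range Subtype.val Subtype.val_injective hadj p
      (fun s hs => ⟨⟨s, hp s hs⟩, rfl⟩) _ _ rfl rfl
  · intro x y
    obtain ⟨p, hp⟩ := h v x.1 x.1.2 y.1 y.1.2 (fun e => x.2 (Subtype.ext e))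
      (fun e => y.2 (Subtype.ext e))
    exact reachable_of_walk_of_range (fun t : ({v}ᶜ : Set B.verts) => (t : V))
      (Subtype.val_injective.comp Subtype.val_injective) (fun a b hab => hadj _ _ hab) p
      (fun s hs => ⟨⟨⟨s, (hp s hs).1⟩, fun e => (hp s hs).2 (congrArg Subtype.val e)⟩, rfl⟩)
      _ _ rfl rfl

/-- After shortening the walk to a path, `v` closes it to a cycle. The subgraph induced on a cycle
is 2-connected, hence lies in a block by finiteness, and that block is complete. -/
theorem IsBlockGraph.isNeighborSeparating [Finite V] (hG : G.IsBlockGraph) :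
    G.IsNeighborSeparating := by
  classical
  intro v w w' hw hw' hne p₀ hp₀
  obtain ⟨p, hp, hvp⟩ : ∃ p : G.Walk w w', p.IsPath ∧ v ∉ p.support :=
    ⟨p₀.bypass, p₀.bypass_isPath, fun h => hp₀ (p₀.support_bypass_subset_support h)⟩
  set S : Set V := insert v {z | z ∈ p.support} with hS
  set B : G.Subgraph := (⊤ : G.Subgraph).induce S with hB
  have hBv : B.verts = S := rfl
  -- Of the two arcs of the cycle from `v` to `s`, a deleted vertex `z` meets only one, so the other
  -- is available.
  have key : ∀ z, z ≠ v → ∀ s ∈ S, s ≠ z →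
      ∃ q : G.Walk v s, ∀ t ∈ q.support, t ∈ S ∧ t ≠ z := by
    intro z hzv s hs hsz
    rcases hs with rfl | hs
    · exact ⟨Walk.nil, by simp [hS, hzv.symm]⟩
    · by_cases hz : z ∈ (p.takeUntil s hs).support
      · have hz' := hp.notMem_support_dropUntil hs hz hsz.symm
        refine ⟨Walk.cons hw' (p.dropUntil s hs).reverse, fun t ht => ?_⟩
        rw [Walk.support_cons, List.mem_cons, Walk.support_reverse, List.mem_reverse] at ht
        rcases ht with rfl | ht
        · exact ⟨by simp [hS], hzv.symm⟩
        · exact ⟨Or.inr (p.support_dropUntil_subset_support hs ht), fun e => hz' (e ▸ ht)⟩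
      · refine ⟨Walk.cons hw (p.takeUntil s hs), fun t ht => ?_⟩
        rw [Walk.support_cons, List.mem_cons] at ht
        rcases ht with rfl | ht
        · exact ⟨by simp [hS], hzv.symm⟩
        · exact ⟨Or.inr (p.support_takeUntil_subset_support hs ht), fun e => hz (e ▸ ht)⟩
  have key' : ∀ s ∈ S, ∃ q : G.Walk v s, ∀ t ∈ q.support, t ∈ S := by
    intro s hs
    rcases hs with rfl | hs
    · exact ⟨Walk.nil, by simp [hS]⟩
    · refine ⟨Walk.cons hw (p.takeUntil s hs), fun t ht => ?_⟩
      rw [Walk.support_cons, List.mem_cons] at ht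
      rcases ht with rfl | ht
      · simp [hS]
      · exact Or.inr (p.support_takeUntil_subset_support hs ht)
  have h2 : B.coe.IsTwoConnected := by
    refine isTwoConnected_of_walks B (fun x hx y hy h => ⟨hx, hy, h⟩) ⟨v, Or.inl rfl⟩ ?_ ?_
    · intro z x hx y hy hxz hyz
      rw [hBv] at hx hy ⊢
      by_cases hz : z = v
      · subst hz
        have hx' := hx.resolve_left hxz
        have hy' := hy.resolve_left hyz
        refine ⟨(p.takeUntil x hx').reverse.append (p.takeUntil y hy'), fun s hs => ?_⟩
        have hsp : s ∈ p.support := by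
          rw [Walk.mem_support_append_iff, Walk.support_reverse, List.mem_reverse] at hs
          exact hs.elim (fun h => p.support_takeUntil_subset_support _ h)
            (fun h => p.support_takeUntil_subset_support _ h)
        exact ⟨Or.inr hsp, fun e => hvp (e ▸ hsp)⟩
      · obtain ⟨q, hq⟩ := key z hz x hx hxz
        obtain ⟨q', hq'⟩ := key z hz y hy hyz
        refine ⟨q.reverse.append q', fun s hs => ?_⟩
        rw [Walk.mem_support_append_iff, Walk.support_reverse, List.mem_reverse] at hs
        exact hs.elim (hq s) (hq' s)
    · intro x hx y hy
      obtain ⟨q, hq⟩ := key' x hx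
      obtain ⟨q', hq'⟩ := key' y hy
      refine ⟨q.reverse.append q', fun s hs => ?_⟩
      rw [Walk.mem_support_append_iff, Walk.support_reverse, List.mem_reverse] at hs
      exact hs.elim (hq s) (hq' s)
  obtain ⟨C, hBC, hC⟩ := Finite.exists_le_maximal
    (p := fun C : G.Subgraph => C.coe.IsTwoConnected) h2
  have hCtop := hG C hC
  have hwC : w ∈ C.verts := hBC.1 (Or.inr p.start_mem_support)
  have hwC' : w' ∈ C.verts := hBC.1 (Or.inr p.end_mem_support)
  have : C.coe.Adj ⟨w, hwC⟩ ⟨w', hwC'⟩ := by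
    rw [hCtop, top_adj]
    exact fun e => hne (congrArg Subtype.val e)
  exact C.adj_sub this

/-- Induction along a walk in the block: if `c` and `a` are both adjacent to `z`, then deleting `z`
leaves them joined, so they are adjacent. Hence the vertices of a block form a clique; by maximality
the block contains all the edges of that clique. -/
theorem IsNeighborSeparating.isBlockGraph (hG : G.IsNeighborSeparating) : G.IsBlockGraph := by
  intro B hB
  have h2 : B.coe.IsTwoConnected := hB.1
  have clique : ∀ x y : B.verts, x ≠ y → G.Adj x y := by
    intro x y
    obtain ⟨p⟩ := h2.1.preconnected y x
    induction p with
    | nil => exact fun h => absurd rfl h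
    | @cons a z c hyz p ih =>
      intro hxy
      by_cases hzx : c = z
      · subst hzx
        exact (B.adj_sub hyz).symm
      · have hxz := ih hzx
        have hza : G.Adj (z : V) a := (B.adj_sub hyz).symm
        obtain ⟨q⟩ := h2.2 z ⟨c, hzx⟩ ⟨a, fun e => B.coe.ne_of_adj hyz e⟩
        let f : B.coe.induce {z}ᶜ →g G :=
          ⟨fun t => (t : V), fun {s t} h => B.adj_sub h⟩
        refine hG hxz.symm hza (fun e => hxy (Subtype.ext e)) (q.map f) ?_
        rw [Walk.support_map, List.mem_map]
        rintro ⟨t, -, ht⟩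
        exact t.2 (Subtype.ext ht)
  have hle : B ≤ (⊤ : G.Subgraph).induce B.verts :=
    ⟨le_rfl, fun x y h => ⟨B.edge_vert h, B.edge_vert h.symm, B.adj_sub h⟩⟩
  have htop : ((⊤ : G.Subgraph).induce B.verts).coe = ⊤ := by
    ext x y
    rw [top_adj]
    exact ⟨fun h => h.ne, fun h => ⟨x.2, y.2, clique x y h⟩⟩
  have hmax := hB.2 (y := (⊤ : G.Subgraph).induce B.verts) (by
    refine ⟨?_, fun z => ?_⟩
    · rw [htop]
      have : Nonempty ((⊤ : G.Subgraph).induce B.verts).verts := h2.1.nonempty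
      exact connected_top
    · intro s t
      by_cases hst : s = t
      · rw [hst]
      · refine Adj.reachable ?_
        rw [htop]
        exact fun e => hst (Subtype.ext e)) hle
  ext x y
  rw [top_adj]
  exact ⟨fun h => h.ne, fun h => hmax.2 ⟨x.2, y.2, clique x y h⟩⟩

theorem IsNeighborSeparating.induce (hG : G.IsNeighborSeparating) (S : Set V) :
    (G.induce S).IsNeighborSeparating := by
  intro v w w' hw hw' hne p hp
  let f : G.induce S →g G := ⟨fun t => (t : V), fun h => h⟩
  refine hG (v := f v) (w := f w) (w' := f w') hw hw' (fun e => hne (Subtype.ext e)) (p.map f) ?_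
  rw [Walk.support_map, List.mem_map]
  rintro ⟨t, ht, e⟩
  exact hp (by rwa [← show t = v from Subtype.ext e])

theorem IsBlockGraph.induce [Finite V] (hG : G.IsBlockGraph) (S : Set V) :
    (G.induce S).IsBlockGraph :=
  (hG.isNeighborSeparating.induce S).isBlockGraph

/-! ### Distances in a block graph -/

/-- A geodesic from `w` to `t` through `v` would make `v` strictly closer to `t` than `w`. -/
theorem exists_walk_notMem_support_of_dist_le {v w t : V} (hr : G.Reachable w t) (hne : w ≠ v)
    (h : G.dist w t ≤ G.dist v t) : ∃ p : G.Walk w t, v ∉ p.support := by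
  classical
  obtain ⟨p, hp⟩ := hr.exists_walk_length_eq_dist
  refine ⟨p, fun hv => ?_⟩
  have h1 := G.dist_le (p.dropUntil v hv)
  have h2 := p.length_dropUntil_lt_length hv hne.symm
  omega

theorem IsNeighborSeparating.adj_of_dist_le (hG : G.IsNeighborSeparating) {v w w' t : V}
    (hw : G.Adj v w) (hw' : G.Adj v w') (hne : w ≠ w') (hr : G.Reachable v t)
    (h : G.dist w t ≤ G.dist v t) (h' : G.dist w' t ≤ G.dist v t) : G.Adj w w' := by
  obtain ⟨p, hp⟩ := exists_walk_notMem_support_of_dist_le (hw.symm.reachable.trans hr) hw.ne' h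
  obtain ⟨q, hq⟩ := exists_walk_notMem_support_of_dist_le (hw'.symm.reachable.trans hr) hw'.ne' h'
  refine hG hw hw' hne (p.append q.reverse) ?_
  rw [Walk.mem_support_append_iff, Walk.support_reverse, List.mem_reverse]
  tauto

/-- Otherwise `x` and `z` are equally far from `t`. The first step `s` of a geodesic from `x` is
joined to `y` via `t` and `z` without meeting `x`, so `s` and `y` are adjacent and `y` is no farther
from `t` than `x`. -/
theorem IsNeighborSeparating.dist_lt_of_triangle (hG : G.IsNeighborSeparating) {x y z t : V}
    (hxy : G.Adj x y) (hxz : G.Adj x z) (hyz : G.Adj y z) (h : G.dist x t < G.dist y t) :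
    G.dist x t < G.dist z t := by
  by_contra! hz
  have hry : G.Reachable y t := Reachable.of_dist_ne_zero (by omega)
  have hrx : G.Reachable x t := hxy.reachable.trans hry
  have hrz : G.Reachable z t := hxz.symm.reachable.trans hrx
  have h1 : ∀ {a b : V}, G.Adj a b → G.dist a t ≤ G.dist b t + 1 := by
    intro a b hab
    have := hab.reachable.dist_triangle_left t
    rw [dist_eq_one_iff_adj.2 hab] at this
    omega
  have e1 := h1 hxy.symm
  have e2 := h1 hyz
  have e3 : G.dist x t ≠ 0 := by
    intro h0
    have hz0 : G.dist z t = 0 := by omega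
    rw [hrx.dist_eq_zero_iff] at h0
    rw [hrz.dist_eq_zero_iff] at hz0
    exact hxz.ne (h0.trans hz0.symm)
  obtain ⟨p, hp⟩ := hrx.exists_walk_length_eq_dist
  cases p with
  | nil => simp at e3
  | @cons _ s _ hxs q =>
    have hq := G.dist_le q
    rw [Walk.length_cons] at hp
    have hst := h1 hxs
    have hsz : s ≠ z := by rintro rfl; exact absurd hz (by omega)
    have hsy : s ≠ y := by rintro rfl; omega
    obtain ⟨p1, hp1⟩ := exists_walk_notMem_support_of_dist_le
      (hxs.symm.reachable.trans hrx) hxs.ne' (by omega : G.dist s t ≤ G.dist x t)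
    obtain ⟨p2, hp2⟩ := exists_walk_notMem_support_of_dist_le hrz hxz.ne' hz
    have := hG hxs hxy hsy (p1.append (p2.reverse.append (Walk.cons hyz.symm Walk.nil))) (by
      simp only [Walk.mem_support_append_iff, Walk.support_reverse, List.mem_reverse,
        Walk.support_cons, Walk.support_nil, List.mem_cons, List.not_mem_nil, not_or]
      exact ⟨hp1, hp2, hxz.ne, hxy.ne, not_false⟩)
    have := h1 this.symm
    omega

end SimpleGraph

/-! ### The centroid structure: parents and siblings -/

namespace SimpleGraph

variable {V : Type u} [Fintype V] {G : SimpleGraph V}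

open Classical in
/-- The number of vertices that are strictly closer to `v` than to `w`. -/
noncomputable def closerCount (G : SimpleGraph V) (v w : V) : ℕ :=
  (Finset.univ.filter fun t => G.dist v t < G.dist w t).card

open Classical in
/-- The number of vertices in the component of `v`. -/
noncomputable def componentCard (G : SimpleGraph V) (v : V) : ℕ :=
  (Finset.univ.filter fun t => G.Reachable v t).card

/-- The sum of the distances to `v`. -/
noncomputable def distSum (G : SimpleGraph V) (v : V) : ℕ := ∑ t, G.dist v t

/-- `G.IsParent p v`: the vertex `p` is adjacent to `v` and more than half of the vertices of their
component are closer to `p` than to `v`. -/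
def IsParent (G : SimpleGraph V) (p v : V) : Prop :=
  G.Adj v p ∧ G.componentCard v < 2 * G.closerCount p v

/-- Two vertices are siblings if they are equal, or adjacent without one being the parent of the
other. -/
def IsSibling (G : SimpleGraph V) (v w : V) : Prop :=
  v = w ∨ (G.Adj v w ∧ ¬ G.IsParent v w ∧ ¬ G.IsParent w v)

/-- The parent and sibling relations turn `G` into a rooted forest of cliques. -/
structure IsCentroidRooted (G : SimpleGraph V) : Prop where
  parent_unique : ∀ ⦃v p q : V⦄, G.IsParent p v → G.IsParent q v → p = q
  sibling_trans : ∀ ⦃v w z : V⦄, G.IsSibling v w → G.IsSibling w z → G.IsSibling v z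
  parent_of_sibling : ∀ ⦃v w p : V⦄, G.IsSibling v w → G.IsParent p v → G.IsParent p w

theorem isSibling_refl (v : V) : G.IsSibling v v := Or.inl rfl

theorem IsSibling.symm {v w : V} (h : G.IsSibling v w) : G.IsSibling w v :=
  h.elim (fun h => Or.inl h.symm) fun h => Or.inr ⟨h.1.symm, h.2.2, h.2.1⟩

theorem adj_iff_isParent_or_isSibling {v w : V} :
    G.Adj v w ↔ v ≠ w ∧ (G.IsParent v w ∨ G.IsParent w v ∨ G.IsSibling v w) := by
  refine ⟨fun h => ⟨h.ne, ?_⟩, ?_⟩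
  · unfold IsSibling; tauto
  · rintro ⟨hne, h | h | h⟩
    · exact h.1.symm
    · exact h.1
    · exact (h.resolve_left hne).1

/-- Along an edge the distance to any vertex changes by at most one. It follows that `distSum` drops
strictly from a vertex to its parent, which provides a rank. -/
theorem Adj.distSum_add_closerCount {v w : V} (h : G.Adj v w) :
    G.distSum v + G.closerCount v w = G.distSum w + G.closerCount w v := by
  classical
  unfold distSum closerCount
  rw [Finset.card_filter, Finset.card_filter, ← Finset.sum_add_distrib, ← Finset.sum_add_distrib]
  refine Finset.sum_congr rfl fun t _ => ?_
  have h1 := h.reachable.dist_triangle_left t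
  have h2 := h.symm.reachable.dist_triangle_left t
  rw [dist_eq_one_iff_adj.2 h] at h1
  rw [dist_eq_one_iff_adj.2 h.symm] at h2
  split_ifs <;> omega

theorem componentCard_eq_of_adj {v w : V} (h : G.Adj v w) :
    G.componentCard v = G.componentCard w := by
  unfold componentCard
  congr 1
  ext t
  simp only [Finset.mem_filter, Finset.mem_univ, true_and]
  exact ⟨fun h' => h.symm.reachable.trans h', fun h' => h.reachable.trans h'⟩

theorem closerCount_add_closerCount_le {v w : V} (h : G.Adj v w) :
    G.closerCount v w + G.closerCount w v ≤ G.componentCard v := by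
  classical
  unfold closerCount componentCard
  rw [← Finset.card_union_of_disjoint]
  · refine Finset.card_le_card fun t ht => ?_
    simp only [Finset.mem_union, Finset.mem_filter, Finset.mem_univ, true_and] at ht ⊢
    rcases ht with ht | ht
    -- `dist` is zero between different components, so a strict inequality already places `t` in
    -- this component.
    · exact h.reachable.trans (Reachable.of_dist_ne_zero (by omega))
    · exact Reachable.of_dist_ne_zero (by omega)
  · rw [Finset.disjoint_left]
    intro t ht ht'
    simp only [Finset.mem_filter, Finset.mem_univ, true_and] at ht ht'
    omega

theorem IsParent.distSum_lt {p v : V} (h : G.IsParent p v) : G.distSum p < G.distSum v := by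
  have h1 := h.1.distSum_add_closerCount
  have h2 := closerCount_add_closerCount_le h.1
  have h3 := h.2
  omega

/-- The two sets cover the component, and `v` lies in both; this makes the inequality strict. -/
theorem componentCard_lt_of_cover {v w z : V} (hw : G.Adj v w) (hz : G.Adj v z)
    (h : ∀ t, G.Reachable v t → G.dist v t < G.dist w t ∨ G.dist v t < G.dist z t) :
    G.componentCard v < G.closerCount v w + G.closerCount v z := by
  classical
  unfold closerCount componentCard
  rw [← Finset.card_union_add_card_inter]
  have h1 : (Finset.univ.filter fun t => G.Reachable v t).card ≤
      ((Finset.univ.filter fun t => G.dist v t < G.dist w t) ∪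
        (Finset.univ.filter fun t => G.dist v t < G.dist z t)).card := by
    refine Finset.card_le_card fun t ht => ?_
    simp only [Finset.mem_union, Finset.mem_filter, Finset.mem_univ, true_and] at ht ⊢
    exact h t ht
  have h2 : 0 < ((Finset.univ.filter fun t => G.dist v t < G.dist w t) ∩
        (Finset.univ.filter fun t => G.dist v t < G.dist z t)).card := by
    refine Finset.card_pos.2 ⟨v, ?_⟩
    simp [dist_eq_one_iff_adj.2 hw.symm, dist_eq_one_iff_adj.2 hz.symm]
  omega

theorem exists_of_componentCard_lt {v w z : V}
    (h : G.componentCard v < G.closerCount w v + G.closerCount z v) :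
    ∃ t, G.dist w t < G.dist v t ∧ G.dist z t < G.dist v t := by
  classical
  by_contra! hc
  unfold closerCount componentCard at h
  rw [← Finset.card_union_of_disjoint] at h
  · refine absurd (Finset.card_le_card fun t ht => ?_) (not_le.2 h)
    simp only [Finset.mem_union, Finset.mem_filter, Finset.mem_univ, true_and] at ht ⊢
    exact Reachable.of_dist_ne_zero (by omega)
  · rw [Finset.disjoint_left]
    intro t ht ht'
    simp only [Finset.mem_filter, Finset.mem_univ, true_and] at ht ht'
    exact absurd ht' (not_lt.2 (hc t ht))

theorem IsNeighborSeparating.closerCount_eq (hG : G.IsNeighborSeparating) {x y z : V}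
    (hxy : G.Adj x y) (hxz : G.Adj x z) (hyz : G.Adj y z) :
    G.closerCount x y = G.closerCount x z := by
  unfold closerCount
  congr 1
  ext t
  simp only [Finset.mem_filter, Finset.mem_univ, true_and]
  exact ⟨hG.dist_lt_of_triangle hxy hxz hyz, hG.dist_lt_of_triangle hxz hxy hyz.symm⟩

/-- If `w` and `z` are not adjacent, no reachable `t` has both of them at most as far away as `v`;
then the vertices closer to `v` than to `w`, or than to `z`, cover the component. -/
theorem IsNeighborSeparating.adj_of_closerCount_le (hG : G.IsNeighborSeparating) {v w z : V}
    (hw : G.Adj v w) (hz : G.Adj v z) (hne : w ≠ z)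
    (h : G.closerCount v w + G.closerCount v z ≤ G.componentCard v) : G.Adj w z := by
  by_contra hwz
  refine absurd (componentCard_lt_of_cover hw hz fun t ht => ?_) (not_lt.2 h)
  by_contra! hc
  exact hwz (hG.adj_of_dist_le hw hz hne ht hc.1 hc.2)

/-- Two majorities meet, so two parents of `v` would be adjacent and each strictly closer than the
other to a common vertex. For the other two axioms, the failure of a majority yields the missing
adjacency, and `closerCount_eq` moves counts between the edges of the resulting triangle. -/
theorem IsNeighborSeparating.isCentroidRooted (hG : G.IsNeighborSeparating) :
    G.IsCentroidRooted where
  parent_unique v p q hp hq := by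
    by_contra hne
    obtain ⟨t, ht, ht'⟩ := exists_of_componentCard_lt (v := v) (w := p) (z := q) (G := G) (by
      have := hp.2
      have := hq.2
      omega)
    have hpq := hG.adj_of_dist_le hp.1 hq.1 hne (Reachable.of_dist_ne_zero (by omega)) ht.le ht'.le
    have h1 := hG.dist_lt_of_triangle hp.1.symm hpq hq.1 ht
    have h2 := hG.dist_lt_of_triangle hq.1.symm hpq.symm hp.1 ht'
    omega
  sibling_trans v w z h1 h2 := by
    rcases h1 with rfl | ⟨a1, b1, c1⟩
    · exact h2
    rcases h2 with rfl | ⟨a2, b2, c2⟩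
    · exact Or.inr ⟨a1, b1, c1⟩
    by_cases hne : v = z
    · exact Or.inl hne
    have e1 := componentCard_eq_of_adj a1
    have e2 := componentCard_eq_of_adj a2
    have hvz : G.Adj v z := by
      refine hG.adj_of_closerCount_le a1.symm a2 hne ?_
      have n1 := mt (fun h => (⟨a1, h⟩ : G.IsParent w v)) c1
      have n2 := mt (fun h => (⟨a2.symm, h⟩ : G.IsParent w z)) b2
      omega
    refine Or.inr ⟨hvz, fun hp => b1 ⟨a1.symm, ?_⟩, fun hp => c2 ⟨a2, ?_⟩⟩
    · rw [hG.closerCount_eq a1 hvz a2, e2]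
      exact hp.2
    · rw [hG.closerCount_eq a2.symm hvz.symm a1.symm, ← e1]
      exact hp.2
  parent_of_sibling v w p h hp := by
    rcases h with rfl | ⟨a, b, c⟩
    · exact hp
    have hne : w ≠ p := by rintro rfl; exact c hp
    have hwp : G.Adj w p := by
      refine hG.adj_of_closerCount_le a hp.1 hne ?_
      have n1 := mt (fun h => (⟨a.symm, h⟩ : G.IsParent v w)) b
      have n2 := closerCount_add_closerCount_le hp.1
      have n3 := hp.2
      have e1 := componentCard_eq_of_adj a
      omega
    refine ⟨hwp, ?_⟩
    rw [hG.closerCount_eq hwp.symm hp.1.symm a.symm, ← componentCard_eq_of_adj a]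
    exact hp.2

end SimpleGraph

/-! ### Relations and counts preserved by magic unitaries -/

namespace IsMagicUnitary

variable {V : Type*} {W : Type*} [Fintype V] [Fintype W] {X : Type*} [Ring X] [StarRing X]
  {U : Matrix W V X}

theorem transpose (hU : IsMagicUnitary U) : IsMagicUnitary U.transpose where
  isSelfAdjoint i j := hU.isSelfAdjoint j i
  idem i j := hU.idem j i
  row_orthogonal i j k h := hU.col_orthogonal j i k h
  col_orthogonal i j k h := hU.row_orthogonal j i k h
  sum_row i := hU.sum_col i
  sum_col i := hU.sum_row i

theorem star_mul_apply (hU : IsMagicUnitary U) (x y : W) (a b : V) :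
    star (U x a * U y b) = U y b * U x a := by
  rw [star_mul, hU.isSelfAdjoint, hU.isSelfAdjoint]

theorem mul_ne_zero_symm (hU : IsMagicUnitary U) {x y : W} {a b : V} (h : U x a * U y b ≠ 0) :
    U y b * U x a ≠ 0 := by
  rw [← hU.star_mul_apply]
  exact star_ne_zero.2 h

theorem exists_mul_ne_zero [Nontrivial X] (hU : IsMagicUnitary U) (x y : W) :
    ∃ a b, U x a * U y b ≠ 0 := by
  by_contra! h
  have : (∑ a, U x a) * (∑ b, U y b) = 0 := by
    simp [Finset.sum_mul_sum, h]
  rw [hU.sum_row, hU.sum_row, one_mul] at this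
  exact one_ne_zero this

end IsMagicUnitary

theorem nsmul_left_cancel_of_ne_zero {X : Type*} [Ring X] [Algebra ℂ X] {z : X} (hz : z ≠ 0)
    {m n : ℕ} (h : m • z = n • z) : m = n := by
  rw [← Nat.cast_smul_eq_nsmul ℂ m, ← Nat.cast_smul_eq_nsmul ℂ n] at h
  exact_mod_cast smul_left_injective ℂ hz h

theorem IsMagicUnitary.card_eq {V W : Type*} [Fintype V] [Fintype W] {X : Type*} [Ring X]
    [StarRing X] [Algebra ℂ X] [Nontrivial X] {U : Matrix W V X} (hU : IsMagicUnitary U) :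
    Fintype.card W = Fintype.card V := by
  have h : ∑ x, ∑ a, U x a = ∑ a, ∑ x, U x a := Finset.sum_comm
  simp only [hU.sum_row, hU.sum_col, Finset.sum_const, Finset.card_univ] at h
  exact nsmul_left_cancel_of_ne_zero one_ne_zero h

theorem SimpleGraph.exists_walk_length_eq_succ_iff {V : Type*} {G : SimpleGraph V} {x y : V}
    {n : ℕ} : (∃ p : G.Walk x y, p.length = n + 1) ↔
      ∃ t, G.Adj x t ∧ ∃ p : G.Walk t y, p.length = n := by
  constructor
  · rintro ⟨p, hp⟩
    cases p with
    | nil => simp at hp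
    | cons h p => exact ⟨_, h, p, by simpa using hp⟩
  · rintro ⟨t, h, p, hp⟩
    exact ⟨.cons h p, by simp [hp]⟩

/-- A pair of binary functions on the vertex sets is compatible with `U` if `U x a * U y b ≠ 0`
forces their values at `(x, y)` and `(a, b)` to agree. -/
def Compatible {V W X α : Type*} [Mul X] [Zero X] (U : Matrix W V X) (f : W → W → α)
    (g : V → V → α) : Prop :=
  ∀ ⦃x y : W⦄ ⦃a b : V⦄, U x a * U y b ≠ 0 → f x y = g a b

namespace Compatible

section

variable {V W X α γ : Type*} [Mul X] [Zero X] {U : Matrix W V X} {f : W → W → α} {g : V → V → α}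

theorem map (h : Compatible U f g) (φ : α → γ) :
    Compatible U (fun x y => φ (f x y)) (fun a b => φ (g a b)) :=
  fun _ _ _ _ hne => congrArg φ (h hne)

theorem transpose (h : Compatible U f g) : Compatible U.transpose g f :=
  fun _ _ _ _ hne => (h hne).symm

end

variable {V W X : Type*} [Fintype V] [Fintype W] [Ring X] [StarRing X] {U : Matrix W V X}
  {α β : Type*} {f : W → W → α} {g : V → V → α} {f' : W → W → β} {g' : V → V → β}

theorem swap (hU : IsMagicUnitary U) (h : Compatible U f g) :
    Compatible U (fun x y => f y x) (fun a b => g b a) :=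
  fun _ _ _ _ hne => h (hU.mul_ne_zero_symm hne)

theorem eq (hU : IsMagicUnitary U) :
    Compatible U (fun x y => x = y) (fun a b => a = b) := by
  intro x y a b hne
  refine propext ⟨?_, ?_⟩
  · rintro rfl
    by_contra hab
    exact hne (hU.row_orthogonal _ _ _ hab)
  · rintro rfl
    by_contra hxy
    exact hne (hU.col_orthogonal _ _ _ hxy)

/-- Multiply the `(x, b)` entry of the intertwining relation by `U x a` on the left and `U y b` on
the right: orthogonality leaves one term on each side. -/
theorem adj (hU : IsMagicUnitary U) {G : SimpleGraph V} {H : SimpleGraph W}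
    (hGH : Intertwines G H U) : Compatible U H.Adj G.Adj := by
  classical
  intro x y a b hne
  have h := congrFun (congrFun hGH x) b
  rw [Matrix.mul_apply, Matrix.mul_apply] at h
  have h1 : U x a * (∑ c, U x c * G.adjMatrix X c b) * U y b =
      if G.Adj a b then U x a * U y b else 0 := by
    rw [Finset.mul_sum, Finset.sum_eq_single a]
    · rw [← mul_assoc, hU.idem, SimpleGraph.adjMatrix_apply]
      split_ifs <;> simp
    · intro c _ hc
      rw [← mul_assoc, hU.row_orthogonal _ _ _ hc.symm, zero_mul]
    · simp
  have h2 : U x a * (∑ z, H.adjMatrix X x z * U z b) * U y b =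
      if H.Adj x y then U x a * U y b else 0 := by
    rw [mul_assoc, Finset.sum_mul, Finset.sum_eq_single y]
    · rw [mul_assoc, hU.idem, SimpleGraph.adjMatrix_apply]
      split_ifs <;> simp
    · intro z _ hz
      rw [mul_assoc, hU.col_orthogonal _ _ _ hz, mul_zero]
    · simp
  have h3 : (if G.Adj a b then U x a * U y b else 0) =
      if H.Adj x y then U x a * U y b else 0 := by
    rw [← h1, ← h2]
    congr 2
  by_cases p : G.Adj a b <;> by_cases q : H.Adj x y <;> simp_all

/-- Insert a row sum or a column sum of `U`, both equal to one, between `U x a` and `U y b`. A term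
`U x a * U t s * U y b` survives only when both adjacent products are nonzero, and then the weights
agree. Thus the two counts are multiples of the same nonzero element. -/
theorem sum [Algebra ℂ X] (hU : IsMagicUnitary U) (h : Compatible U f g)
    (h' : Compatible U f' g') (φ : α → β → ℕ) :
    Compatible U (fun x y => ∑ t, φ (f x t) (f' t y)) (fun a b => ∑ s, φ (g a s) (g' s b)) := by
  intro x y a b hne
  refine nsmul_left_cancel_of_ne_zero hne ?_
  have key : ∀ t s, φ (f x t) (f' t y) • (U x a * U t s * U y b) =
      φ (g a s) (g' s b) • (U x a * U t s * U y b) := by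
    intro t s
    by_cases h1 : U x a * U t s = 0
    · simp [h1]
    by_cases h2 : U t s * U y b = 0
    · simp [mul_assoc, h2]
    rw [h h1, h' h2]
  have e1 : ∑ t, ∑ s, φ (f x t) (f' t y) • (U x a * U t s * U y b) =
      (∑ t, φ (f x t) (f' t y)) • (U x a * U y b) := by
    rw [Finset.sum_smul]
    refine Finset.sum_congr rfl fun t _ => ?_
    rw [← Finset.smul_sum, ← Finset.sum_mul, ← Finset.mul_sum, hU.sum_row, mul_one]
  have e2 : ∑ s, ∑ t, φ (g a s) (g' s b) • (U x a * U t s * U y b) =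
      (∑ s, φ (g a s) (g' s b)) • (U x a * U y b) := by
    rw [Finset.sum_smul]
    refine Finset.sum_congr rfl fun s _ => ?_
    rw [← Finset.smul_sum, ← Finset.sum_mul, ← Finset.mul_sum, hU.sum_col, mul_one]
  rw [← e1, ← e2, Finset.sum_comm]
  exact Finset.sum_congr rfl fun s _ => Finset.sum_congr rfl fun t _ => key t s

theorem exists_and [Algebra ℂ X] (hU : IsMagicUnitary U) {f f' : W → W → Prop}
    {g g' : V → V → Prop} (h : Compatible U f g) (h' : Compatible U f' g') :
    Compatible U (fun x y => ∃ t, f x t ∧ f' t y) (fun a b => ∃ s, g a s ∧ g' s b) := by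
  classical
  have := (h.sum hU h' fun p q => if p ∧ q then 1 else 0).map fun n => n ≠ 0
  simpa using this

variable [Algebra ℂ X] {G : SimpleGraph V} {H : SimpleGraph W}

theorem exists_walk (hU : IsMagicUnitary U) (hGH : Compatible U H.Adj G.Adj) (n : ℕ) :
    Compatible U (fun x y => ∃ p : H.Walk x y, p.length = n)
      (fun a b => ∃ p : G.Walk a b, p.length = n) := by
  induction n with
  | zero =>
    simpa only [SimpleGraph.Walk.exists_length_eq_zero_iff] using eq hU
  | succ n ih =>
    simp only [SimpleGraph.exists_walk_length_eq_succ_iff]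
    exact hGH.exists_and hU ih

theorem reachable (hU : IsMagicUnitary U) (hGH : Compatible U H.Adj G.Adj) :
    Compatible U H.Reachable G.Reachable := by
  intro x y a b hne
  have h := fun n => exists_walk hU hGH n hne
  refine propext ⟨?_, ?_⟩
  · rintro ⟨p⟩
    obtain ⟨q, -⟩ := (h p.length).mp ⟨p, rfl⟩
    exact ⟨q⟩
  · rintro ⟨p⟩
    obtain ⟨q, -⟩ := (h p.length).mpr ⟨p, rfl⟩
    exact ⟨q⟩

theorem dist (hU : IsMagicUnitary U) (hGH : Compatible U H.Adj G.Adj) :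
    Compatible U H.dist G.dist := by
  intro x y a b hne
  rw [SimpleGraph.dist_eq_sInf, SimpleGraph.dist_eq_sInf]
  congr 1
  ext n
  exact iff_of_eq (exists_walk hU hGH n hne)

theorem closerCount (hU : IsMagicUnitary U) (hGH : Compatible U H.Adj G.Adj) :
    Compatible U H.closerCount G.closerCount := by
  classical
  have h := dist hU hGH
  have := h.sum hU h fun m n => if m < n then 1 else 0
  intro x y a b hne
  have := this hne
  simp only [SimpleGraph.closerCount, Finset.card_filter]
  simpa only [SimpleGraph.dist_comm (u := y), SimpleGraph.dist_comm (u := b)] using this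

theorem componentCard (hU : IsMagicUnitary U) (hGH : Compatible U H.Adj G.Adj) :
    Compatible U (fun x _ => H.componentCard x) (fun a _ => G.componentCard a) := by
  classical
  have h := reachable hU hGH
  have := h.sum hU h fun p _ => if p then 1 else 0
  intro x y a b hne
  have := this hne
  simp only [SimpleGraph.componentCard, Finset.card_filter]
  convert this

theorem isParent (hU : IsMagicUnitary U) (hGH : Compatible U H.Adj G.Adj) :
    Compatible U H.IsParent G.IsParent := by
  intro x y a b hne
  have h1 := componentCard hU hGH (hU.mul_ne_zero_symm hne)
  have h2 := closerCount hU hGH hne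
  have h3 := hGH (hU.mul_ne_zero_symm hne)
  simp only [SimpleGraph.IsParent, h1, h2, h3]

theorem isSibling (hU : IsMagicUnitary U) (hGH : Compatible U H.Adj G.Adj) :
    Compatible U H.IsSibling G.IsSibling := by
  intro x y a b hne
  have h1 := isParent hU hGH (hU.mul_ne_zero_symm hne)
  have h2 := isParent hU hGH hne
  have h3 := hGH hne
  have h4 := eq hU hne
  simp only [SimpleGraph.IsSibling, h1, h2, h3, h4]

/-- Each axiom says that a composite of two compatible relations is contained in a compatible
relation. Any pair of vertices of `H` has a partner pair in `G` with nonzero product, where the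
axiom is known. -/
theorem isCentroidRooted [Nontrivial X] (hU : IsMagicUnitary U)
    (hGH : Compatible U H.Adj G.Adj) (hG : G.IsCentroidRooted) : H.IsCentroidRooted where
  parent_unique v p q hp hq := by
    obtain ⟨a, b, hab⟩ := hU.exists_mul_ne_zero p q
    have hP := isParent hU hGH
    obtain ⟨c, h1, h2⟩ := (hP.exists_and hU (hP.swap hU) hab).mp ⟨v, hp, hq⟩
    exact (eq hU hab).mpr (hG.parent_unique h1 h2)
  sibling_trans v w z h1 h2 := by
    obtain ⟨a, b, hab⟩ := hU.exists_mul_ne_zero v z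
    have hS := isSibling hU hGH
    obtain ⟨c, h1, h2⟩ := (hS.exists_and hU hS hab).mp ⟨w, h1, h2⟩
    exact (hS hab).mpr (hG.sibling_trans h1 h2)
  parent_of_sibling v w p h1 h2 := by
    obtain ⟨a, b, hab⟩ := hU.exists_mul_ne_zero p w
    have hS := isSibling hU hGH
    have hP := isParent hU hGH
    obtain ⟨c, h1, h2⟩ := (hP.exists_and hU hS hab).mp ⟨v, h2, h1⟩
    exact (hP hab).mpr (hG.parent_of_sibling h2 h1)

theorem exists_isParent (hU : IsMagicUnitary U) (hGH : Compatible U H.Adj G.Adj) {x : W} {a : V}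
    (h : U x a ≠ 0) : (∃ p, H.IsParent p x) ↔ ∃ q, G.IsParent q a := by
  -- Pairing `x` with itself turns a binary composite into a property of a single vertex.
  have hne : U x a * U x a ≠ 0 := by rwa [hU.idem]
  have hP := isParent hU hGH
  simpa using iff_of_eq ((hP.swap hU).exists_and hU hP hne)

end Compatible

/-! ### Rooted trees, subtree types and embeddings -/

theorem Finset.card_subtype_filter {M α : Type*} [DecidableEq α] (s : Finset M) (f : M → α) (t : α) :
    Fintype.card {y : s // f y = t} = (s.filter fun y => f y = t).card := by
  rw [Fintype.card_subtype, ← Finset.card_map (Function.Embedding.subtype _)]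
  congr 1
  ext y
  simp [and_comm]

/-- A rooted tree on the type `N`, given by the parent function and a rank which increases from
parents to children. -/
structure ParentTree (N : Type*) where
  root : N
  par : N → N
  rank : N → ℕ
  rank_par_lt : ∀ y, y ≠ root → rank (par y) < rank y

namespace ParentTree

variable {N N' : Type*} {T : ParentTree N} {T' : ParentTree N'}

/-- Descendants of a node, including the node itself. -/
inductive Desc (T : ParentTree N) (k : N) : N → Prop
  | refl : Desc T k k
  | step {a : N} (ha : a ≠ T.root) (h : Desc T k (T.par a)) : Desc T k a

theorem Desc.rank_le {k a : N} (h : T.Desc k a) : T.rank k ≤ T.rank a := by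
  induction h with
  | refl => rfl
  | step ha _ ih => exact ih.trans (T.rank_par_lt _ ha).le

theorem Desc.trans {k l a : N} (h : T.Desc k l) (h' : T.Desc l a) : T.Desc k a := by
  induction h' with
  | refl => exact h
  | step ha _ ih => exact .step ha ih

theorem Desc.total {k l a : N} (h : T.Desc k a) (h' : T.Desc l a) : T.Desc k l ∨ T.Desc l k := by
  induction h with
  | refl => exact Or.inr h'
  | step ha h ih =>
    cases h' with
    | refl => exact Or.inl (.step ha h)
    | step _ h' => exact ih h'

theorem Desc.eq_of_par_eq {k l : N} (h : T.Desc k l) (hk : k ≠ T.root)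
    (hp : T.par k = T.par l) : k = l := by
  cases h with
  | refl => rfl
  | step _ h =>
    have h1 := h.rank_le
    have h2 := T.rank_par_lt k hk
    rw [← hp] at h1
    omega

/-- Injective maps between rooted trees that preserve roots and parents. -/
structure IsEmbedding (T' : ParentTree N') (T : ParentTree N) (Φ : N' → N) : Prop where
  injective : Function.Injective Φ
  map_root : Φ T'.root = T.root
  map_par : ∀ y, y ≠ T'.root → Φ (T'.par y) = T.par (Φ y)

open Classical in
/-- The map obtained by choosing the images of the children of each node from the top down. -/
noncomputable def extend (T' : ParentTree N') (T : ParentTree N) (g : N' → N → N' → N) (y : N') :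
    N :=
  if h : y = T'.root then T.root else g (T'.par y) (extend T' T g (T'.par y)) y
termination_by T'.rank y
decreasing_by exact T'.rank_par_lt y h

theorem extend_root (g : N' → N → N' → N) : extend T' T g T'.root = T.root := by
  rw [extend, dif_pos rfl]

theorem extend_of_ne_root (g : N' → N → N' → N) {y : N'} (h : y ≠ T'.root) :
    extend T' T g y = g (T'.par y) (extend T' T g (T'.par y)) y := by
  rw [extend, dif_neg h]

theorem par_induction {T' : ParentTree N'} {p : N' → Prop} (h0 : p T'.root)
    (h1 : ∀ y, y ≠ T'.root → p (T'.par y) → p y) (y : N') : p y := by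
  induction hn : T'.rank y using Nat.strong_induction_on generalizing y with
  | _ n ih =>
    subst hn
    by_cases h : y = T'.root
    · exact h ▸ h0
    · exact h1 y h (ih _ (T'.rank_par_lt y h) _ rfl)

variable [Fintype N] [Fintype N']

open Classical in
/-- The children of a node. -/
noncomputable def children (T : ParentTree N) (x : N) : Finset N :=
  Finset.univ.filter fun y => y ≠ T.root ∧ T.par y = x

theorem mem_children {x y : N} : y ∈ T.children x ↔ y ≠ T.root ∧ T.par y = x := by
  simp [children]

theorem mem_children_par {y : N} (hy : y ≠ T.root) : y ∈ T.children (T.par y) :=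
  mem_children.2 ⟨hy, rfl⟩

/-- A measure which decreases from parents to children. -/
def height (T : ParentTree N) (x : N) : ℕ := Finset.univ.sup T.rank - T.rank x

theorem height_lt {x y : N} (hy : y ∈ T.children x) : T.height y < T.height x := by
  obtain ⟨h, rfl⟩ := mem_children.1 hy
  have h1 := T.rank_par_lt y h
  have h2 : T.rank y ≤ Finset.univ.sup T.rank := Finset.le_sup (Finset.mem_univ y)
  unfold height
  omega

/-- A code for the isomorphism type of the subtree below a node. -/
noncomputable def type (T : ParentTree N) (x : N) : ℕ :=
  Encodable.encode ((T.children x).attach.val.map fun y => type T y.1)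
termination_by T.height x
decreasing_by exact height_lt y.2

theorem type_def (x : N) : T.type x = Encodable.encode ((T.children x).val.map T.type) := by
  rw [type]
  congr 1
  exact Multiset.attach_map_val' (T.children x).val T.type

open Classical in
theorem type_eq_iff {x : N'} {a : N} : T'.type x = T.type a ↔
    ∀ t, ((T'.children x).filter fun y => T'.type y = t).card =
      ((T.children a).filter fun b => T.type b = t).card := by
  rw [type_def, type_def, Encodable.encode_inj, Multiset.ext]
  refine forall_congr' fun t => ?_
  rw [Multiset.count_map, Multiset.count_map]
  simp only [Finset.card_def, Finset.filter_val, eq_comm]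

theorem exists_children_map {x : N'} {a : N} (h : T'.type x = T.type a) :
    ∃ e : N' → N, (∀ y ∈ T'.children x, e y ∈ T.children a ∧ T.type (e y) = T'.type y) ∧
      Set.InjOn e (T'.children x) := by
  classical
  rw [type_eq_iff] at h
  have hc : ∀ t, Nonempty ({y : T'.children x // T'.type y = t} ≃
      {b : T.children a // T.type b = t}) := by
    intro t
    refine ⟨Fintype.equivOfCardEq ?_⟩
    rw [Finset.card_subtype_filter, Finset.card_subtype_filter, h t]
  let e := Equiv.ofFiberEquiv (f := fun y : T'.children x => T'.type y)
    (g := fun b : T.children a => T.type b) fun t => (hc t).some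
  have he : ∀ y, T.type (e y) = T'.type y := fun y =>
    Equiv.ofFiberEquiv_map (f := fun y : T'.children x => T'.type y)
      (g := fun b : T.children a => T.type b) _ y
  -- The value `T.root` away from the children of `x` is a dummy.
  refine ⟨fun y => if hy : y ∈ T'.children x then e ⟨y, hy⟩ else T.root, fun y hy => ?_, ?_⟩
  · simp only [hy, dif_pos]
    exact ⟨(e ⟨y, hy⟩).2, he ⟨y, hy⟩⟩
  · intro y hy z hz hyz
    rw [Finset.mem_coe] at hy hz
    simp only [hy, hz, dif_pos] at hyz
    exact congrArg Subtype.val (e.injective (Subtype.ext hyz))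

theorem eq_of_desc_of_desc {p k l a : N} (hk : k ∈ T.children p) (hl : l ∈ T.children p)
    (h : T.Desc k a) (h' : T.Desc l a) : k = l := by
  rw [mem_children] at hk hl
  rcases h.total h' with h | h
  · exact h.eq_of_par_eq hk.1 (hk.2.trans hl.2.symm)
  · exact (h.eq_of_par_eq hl.1 (hl.2.trans hk.2.symm)).symm

/-- From the root downwards each node and its image have the same type, so the guarantee on `g`
applies at every step. Nodes with equal images have parents with equal images, hence a common parent
by induction, where `g` is injective. -/
theorem isEmbedding_extend {g : N' → N → N' → N} (hroot : T'.type T'.root = T.type T.root)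
    (hg : ∀ x a, T'.type x = T.type a →
      (∀ y ∈ T'.children x, g x a y ∈ T.children a ∧ T.type (g x a y) = T'.type y) ∧
        Set.InjOn (g x a) (T'.children x)) :
    IsEmbedding T' T (extend T' T g) := by
  have htype : ∀ y, T'.type y = T.type (extend T' T g y) := by
    refine par_induction (by rw [extend_root, hroot]) fun y hy ih => ?_
    rw [extend_of_ne_root g hy]
    exact (((hg _ _ ih).1 y (mem_children_par hy)).2).symm
  have hmem : ∀ y, y ≠ T'.root →
      extend T' T g y ∈ T.children (extend T' T g (T'.par y)) := by
    intro y hy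
    rw [extend_of_ne_root g hy]
    exact ((hg _ _ (htype _)).1 y (mem_children_par hy)).1
  refine ⟨?_, extend_root g, fun y hy => (mem_children.1 (hmem y hy)).2.symm⟩
  have hinj : ∀ y z, extend T' T g y = extend T' T g z → y = z := by
    refine par_induction (T' := T') ?_ fun y hy ih z hyz => ?_
    · intro z hz
      by_contra hne
      rw [extend_root] at hz
      exact (mem_children.1 (hmem z (Ne.symm hne))).1 hz.symm
    · have hz : z ≠ T'.root := by
        rintro rfl
        rw [extend_root] at hyz
        exact (mem_children.1 (hmem y hy)).1 hyz
      have hp := ih (T'.par z) (by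
        rw [← (mem_children.1 (hmem y hy)).2, hyz, (mem_children.1 (hmem z hz)).2])
      have hz' : z ∈ T'.children (T'.par y) := mem_children.2 ⟨hz, hp.symm⟩
      refine (hg _ _ (htype _)).2 (mem_children_par hy) hz' ?_
      rw [← extend_of_ne_root g hy, hyz, extend_of_ne_root g hz, hp]
  exact fun y z => hinj y z

theorem exists_isEmbedding (h : T'.type T'.root = T.type T.root) : ∃ Φ, IsEmbedding T' T Φ := by
  classical
  have key : ∀ (x : N') (a : N), ∃ e : N' → N, T'.type x = T.type a →
      (∀ y ∈ T'.children x, e y ∈ T.children a ∧ T.type (e y) = T'.type y) ∧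
        Set.InjOn e (T'.children x) := by
    intro x a
    by_cases h : T'.type x = T.type a
    · obtain ⟨e, he⟩ := exists_children_map h
      exact ⟨e, fun _ => he⟩
    · exact ⟨fun _ => T.root, fun h' => absurd h' h⟩
  choose g hg using key
  exact ⟨_, isEmbedding_extend h hg⟩

/-- Distinct siblings with isomorphic subtrees. -/
structure IsSwapPair (T : ParentTree N) (s t : N) : Prop where
  left_ne_root : s ≠ T.root
  right_ne_root : t ≠ T.root
  ne : s ≠ t
  par_eq : T.par s = T.par t
  type_eq : T.type s = T.type t

theorem IsSwapPair.exists_isEmbedding {s t : N} (h : T.IsSwapPair s t) :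
    ∃ Φ, IsEmbedding T T Φ ∧ Φ s = t ∧ ∀ y, ¬ T.Desc s y → ¬ T.Desc t y → Φ y = y := by
  classical
  -- On the children of a node mapped to itself take the identity, except below the common parent of
  -- `s` and `t`, where these two are exchanged; elsewhere any matching of types will do.
  have key : ∀ (x a : N), ∃ e : N → N, (T.type x = T.type a →
      (∀ y ∈ T.children x, e y ∈ T.children a ∧ T.type (e y) = T.type y) ∧
        Set.InjOn e (T.children x)) ∧ (x = a → ∀ y, y ≠ s → y ≠ t → e y = y) ∧
      (x = T.par s → x = a → e s = t) := by
    intro x a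
    by_cases hxa : x = a
    · subst hxa
      by_cases hx : x = T.par s
      · subst hx
        refine ⟨Equiv.swap s t, fun _ => ⟨fun y hy => ?_, (Equiv.injective _).injOn⟩,
          fun _ y => Equiv.swap_apply_of_ne_of_ne, fun _ _ => Equiv.swap_apply_left s t⟩
        by_cases hs : y = s
        · subst hs
          rw [Equiv.swap_apply_left]
          exact ⟨mem_children.2 ⟨h.right_ne_root, h.par_eq.symm⟩, h.type_eq.symm⟩
        · by_cases ht : y = t
          · subst ht
            rw [Equiv.swap_apply_right]
            exact ⟨mem_children.2 ⟨h.left_ne_root, rfl⟩, h.type_eq⟩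
          · rw [Equiv.swap_apply_of_ne_of_ne hs ht]
            exact ⟨hy, rfl⟩
      · exact ⟨id, fun _ => ⟨fun y hy => ⟨hy, rfl⟩, Function.injective_id.injOn⟩,
          fun _ _ _ _ => rfl, fun h' => absurd h' hx⟩
    · by_cases ht : T.type x = T.type a
      · obtain ⟨e, he⟩ := exists_children_map ht
        exact ⟨e, fun _ => he, fun h' => absurd h' hxa, fun _ h' => absurd h' hxa⟩
      · exact ⟨id, fun h' => absurd h' ht, fun h' => absurd h' hxa, fun _ h' => absurd h' hxa⟩
  choose g hg hfix hs using key
  have hid : ∀ y, ¬ T.Desc s y → ¬ T.Desc t y → extend T T g y = y := by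
    refine par_induction (fun _ _ => extend_root g) fun y hy ih h1 h2 => ?_
    rw [extend_of_ne_root g hy, ih (fun h' => h1 (.step hy h')) (fun h' => h2 (.step hy h'))]
    exact hfix _ _ rfl y (fun e => h1 (e ▸ .refl)) (fun e => h2 (e ▸ .refl))
  refine ⟨extend T T g, isEmbedding_extend rfl hg, ?_, hid⟩
  rw [extend_of_ne_root g h.left_ne_root, hid]
  · exact hs _ _ rfl rfl
  · intro hd
    have h1 := hd.rank_le
    have h2 := T.rank_par_lt s h.left_ne_root
    omega
  · intro hd
    have h1 := hd.rank_le
    have h2 := T.rank_par_lt t h.right_ne_root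
    rw [h.par_eq] at h1
    omega

/-- There are two pairs of siblings with isomorphic subtrees such that the subtrees below the first
pair are disjoint from those below the second pair. -/
def HasDisjointSwaps (T : ParentTree N) : Prop :=
  ∃ s t s' t', T.IsSwapPair s t ∧ T.IsSwapPair s' t' ∧
    ∀ z, T.Desc s z ∨ T.Desc t z → ¬ (T.Desc s' z ∨ T.Desc t' z)

end ParentTree

/-! ### Magic unitaries between rooted trees -/

namespace ParentTree

variable {N N' : Type*}

/-- Pairs of nodes obtained from `(p, q)` by descending simultaneously. -/
inductive Lift (T' : ParentTree N') (T : ParentTree N) (p : N') (q : N) : N' → N → Prop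
  | refl : Lift T' T p q p q
  | step {x : N'} {a : N} (hx : x ≠ T'.root) (ha : a ≠ T.root)
      (h : Lift T' T p q (T'.par x) (T.par a)) : Lift T' T p q x a

variable {T : ParentTree N} {T' : ParentTree N'}

theorem Lift.desc {p x : N'} {q a : N} (h : Lift T' T p q x a) : T.Desc q a := by
  induction h with
  | refl => exact .refl
  | step _ ha _ ih => exact .step ha ih

theorem Lift.rank_le {p x : N'} {q a : N} (h : Lift T' T p q x a) : T'.rank p ≤ T'.rank x := by
  induction h with
  | refl => rfl
  | step hx _ _ ih => exact ih.trans (T'.rank_par_lt _ hx).le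

variable [Fintype N] [Fintype N']

theorem Lift.eq_or_exists {p x : N'} {q a : N} (h : Lift T' T p q x a) :
    (x = p ∧ a = q) ∨
      ∃ x' ∈ T'.children p, ∃ a' ∈ T.children q, Lift T' T x' a' x a := by
  induction h with
  | refl => exact Or.inl ⟨rfl, rfl⟩
  | @step x a hx ha h ih =>
    rcases ih with ⟨h1, h2⟩ | ⟨x', hx', a', ha', h'⟩
    · exact Or.inr ⟨x, mem_children.2 ⟨hx, h1⟩, a, mem_children.2 ⟨ha, h2⟩, .refl⟩
    · exact Or.inr ⟨x', hx', a', ha', .step hx ha h'⟩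

variable {X : Type*} [Ring X] [StarRing X]

/-- A magic unitary between rooted trees that is compatible with the parent functions. -/
structure IsTreeMagic (T' : ParentTree N') (T : ParentTree N) (U : Matrix N' N X) : Prop
    extends IsMagicUnitary U where
  root_root : U T'.root T.root = 1
  sum_children_right : ∀ y, y ≠ T'.root → ∀ a, ∑ b ∈ T.children a, U y b = U (T'.par y) a
  sum_children_left : ∀ b, b ≠ T.root → ∀ x, ∑ y ∈ T'.children x, U y b = U x (T.par b)

namespace IsTreeMagic

variable {U : Matrix N' N X}

theorem apply_root_left (hU : IsTreeMagic T' T U) {a : N} (ha : a ≠ T.root) :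
    U T'.root a = 0 := by
  rw [← one_mul (U T'.root a), ← hU.root_root, hU.row_orthogonal _ _ _ ha.symm]

theorem apply_root_right (hU : IsTreeMagic T' T U) {x : N'} (hx : x ≠ T'.root) :
    U x T.root = 0 := by
  rw [← one_mul (U x T.root), ← hU.root_root, hU.col_orthogonal _ _ _ hx.symm]

theorem eq_root_iff (hU : IsTreeMagic T' T U) {x : N'} {a : N} (h : U x a ≠ 0) :
    x = T'.root ↔ a = T.root := by
  constructor
  · rintro rfl
    by_contra ha
    exact h (hU.apply_root_left ha)
  · rintro rfl
    by_contra hx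
    exact h (hU.apply_root_right hx)

/-- The entry at the parents is the sum of `U y c` over the children `c` of `T.par b`, so it
dominates each summand. Hence entries decrease down the trees. -/
theorem par_mul (hU : IsTreeMagic T' T U) {y : N'} {b : N} (hy : y ≠ T'.root) (hb : b ≠ T.root) :
    U (T'.par y) (T.par b) * U y b = U y b := by
  classical
  rw [← hU.sum_children_right y hy, Finset.sum_mul, Finset.sum_eq_single b, hU.idem]
  · intro c _ hc
    exact hU.row_orthogonal _ _ _ hc
  · exact fun h => absurd (mem_children_par hb) h

theorem lift_mul (hU : IsTreeMagic T' T U) {p x : N'} {q a : N} (h : Lift T' T p q x a) :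
    U p q * U x a = U x a := by
  induction h with
  | refl => exact hU.idem p q
  | step hx ha _ ih => rw [← hU.par_mul hx ha, ← mul_assoc, ih]

theorem mul_lift (hU : IsTreeMagic T' T U) {p x : N'} {q a : N} (h : Lift T' T p q x a) :
    U x a * U p q = U x a := by
  rw [← hU.star_mul_apply, hU.lift_mul h, hU.isSelfAdjoint]

theorem par_ne_zero (hU : IsTreeMagic T' T U) {x : N'} {a : N} (h : U x a ≠ 0)
    (hx : x ≠ T'.root) : a ≠ T.root ∧ U (T'.par x) (T.par a) ≠ 0 := by
  have ha : a ≠ T.root := fun e => hx ((hU.eq_root_iff h).2 e)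
  refine ⟨ha, fun h0 => h ?_⟩
  rw [← hU.par_mul hx ha, h0, zero_mul]

theorem lift_root (hU : IsTreeMagic T' T U) (x : N') :
    ∀ a, U x a ≠ 0 → Lift T' T T'.root T.root x a := by
  refine par_induction (T' := T')
    (p := fun x => ∀ a, U x a ≠ 0 → Lift T' T T'.root T.root x a) (fun a h => ?_) (fun y hy ih a h => ?_) x
  · rw [(hU.eq_root_iff h).1 rfl]
    exact .refl
  · obtain ⟨h1, h2⟩ := hU.par_ne_zero h hy
    exact .step hy h1 (ih _ h2)

theorem exists_lift (hU : IsTreeMagic T' T U) {p x : N'} {q a : N} (h : Lift T' T p q x a) :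
    ∀ c, U x c ≠ 0 → ∃ c', Lift T' T p c' x c ∧ U p c' ≠ 0 := by
  induction h with
  | refl => exact fun c hc => ⟨c, .refl, hc⟩
  | step hx _ _ ih =>
    intro c hc
    obtain ⟨h1, h2⟩ := hU.par_ne_zero hc hx
    obtain ⟨c', h3, h4⟩ := ih _ h2
    exact ⟨c', .step hx h1 h3, h4⟩

/-- Nonzero entries climb in parallel, which gives `c'`. The product at `(y', b')` and `(x', c')` is
still nonzero: dominating both factors by row `p` puts `c'` below `q`, and column orthogonality
separates `c'` from `b'`. -/
theorem exists_lift_of_mul_ne_zero (hU : IsTreeMagic T' T U) {p x' y' x y : N'} {q a' b' a b c : N}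
    (hx' : x' ∈ T'.children p) (hy' : y' ∈ T'.children p) (hb' : b' ∈ T.children q)
    (ha : Lift T' T x' a' x a) (hb : Lift T' T y' b' y b) (hxy : x' ≠ y')
    (hne : U y b * U x c ≠ 0) :
    ∃ c' ∈ T.children q, Lift T' T x' c' x c ∧ U x' c' ≠ 0 ∧ c' ≠ b' := by
  have hxc : U x c ≠ 0 := right_ne_zero_of_mul hne
  obtain ⟨c', h1, h2⟩ := hU.exists_lift ha c hxc
  obtain ⟨hx0, hxp⟩ := mem_children.1 hx'
  obtain ⟨hy0, hyp⟩ := mem_children.1 hy'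
  obtain ⟨hb0, hbp⟩ := mem_children.1 hb'
  have hc0 := (hU.par_ne_zero h2 hx0).1
  have h3 : U y' b' * U x' c' ≠ 0 := by
    intro h0
    refine hne ?_
    rw [← hU.mul_lift hb, ← hU.lift_mul h1, ← mul_assoc, mul_assoc (U y b), h0, mul_zero, zero_mul]
  refine ⟨c', mem_children.2 ⟨hc0, ?_⟩, h1, h2, ?_⟩
  · by_contra hpc
    refine h3 ?_
    have hlb : Lift T' T p q y' b' := .step hy0 hb0 (by rw [hyp, hbp]; exact .refl)
    have hlc : Lift T' T p (T.par c') x' c' := .step hx0 hc0 (by rw [hxp]; exact .refl)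
    rw [← hU.mul_lift hlb, ← hU.lift_mul hlc, ← mul_assoc, mul_assoc (U y' b'),
      hU.row_orthogonal _ _ _ (Ne.symm hpc), mul_zero, zero_mul]
  · rintro rfl
    exact h3 (hU.col_orthogonal _ _ _ hxy.symm)

variable [Algebra ℂ X]

/-- Sum `U y b` over the children `y` of `x` and `b` of `a` of a given type. By induction entries
between different types vanish, so summing in either order gives the number of such children times
`U x a`. -/
theorem type_eq (hU : IsTreeMagic T' T U) (x : N') : ∀ a, U x a ≠ 0 → T'.type x = T.type a := by
  classical
  induction hn : T'.height x using Nat.strong_induction_on generalizing x with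
  | _ n ih =>
    subst hn
    intro a ha
    rw [type_eq_iff]
    intro t
    refine nsmul_left_cancel_of_ne_zero ha ?_
    have ih' : ∀ y ∈ T'.children x, ∀ b, U y b ≠ 0 → T'.type y = T.type b :=
      fun y hy => ih _ (height_lt hy) y rfl
    have e1 : ∀ y ∈ (T'.children x).filter fun y => T'.type y = t,
        ∑ b ∈ (T.children a).filter fun b => T.type b = t, U y b = U x a := by
      intro y hy
      rw [Finset.mem_filter] at hy
      obtain ⟨hy, hyt⟩ := hy
      obtain ⟨h1, rfl⟩ := mem_children.1 hy
      rw [← hU.sum_children_right y h1]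
      refine Finset.sum_filter_of_ne fun b _ hb => ?_
      rw [← ih' y hy b hb, hyt]
    have e2 : ∀ b ∈ (T.children a).filter fun b => T.type b = t,
        ∑ y ∈ (T'.children x).filter fun y => T'.type y = t, U y b = U x a := by
      intro b hb
      rw [Finset.mem_filter] at hb
      obtain ⟨hb, hbt⟩ := hb
      obtain ⟨h1, rfl⟩ := mem_children.1 hb
      rw [← hU.sum_children_left b h1]
      refine Finset.sum_filter_of_ne fun y hy hy0 => ?_
      rw [ih' y hy b hy0, hbt]
    rw [← Finset.sum_const, ← Finset.sum_const, ← Finset.sum_congr rfl e1,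
      ← Finset.sum_congr rfl e2, Finset.sum_comm]

/-- Climb from `a` and `c` until the two distinct nodes have the same parent; both have the type of
the corresponding node above `x`. -/
theorem exists_isSwapPair (hU : IsTreeMagic T' T U) {p x : N'} {q a : N}
    (h : Lift T' T p q x a) : ∀ c, Lift T' T p q x c → U x a ≠ 0 → U x c ≠ 0 → a ≠ c →
      ∃ s t, T.IsSwapPair s t ∧ T.Desc q s ∧ T.Desc q t := by
  induction h with
  | refl =>
    intro c hc _ _ hne
    cases hc with
    | refl => exact absurd rfl hne
    | step hx _ h =>
      -- A descent from `p` to itself with at least one step contradicts the rank.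
      have h1 := h.rank_le
      have h2 := T'.rank_par_lt _ hx
      omega
  | @step x a hx ha h ih =>
    intro c hc h1 h2 hne
    cases hc with
    | refl =>
      have h1 := h.rank_le
      have h2 := T'.rank_par_lt _ hx
      omega
    | step _ hc' h' =>
      by_cases hp : T.par a = T.par c
      · refine ⟨a, c, ⟨ha, hc', hne, hp, ?_⟩, (Lift.step hx ha h).desc, (Lift.step hx hc' h').desc⟩
        rw [← hU.type_eq x a h1, ← hU.type_eq x c h2]
      · exact ih _ h' (hU.par_ne_zero h1 hx).2 (hU.par_ne_zero h2 hx).2 hp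

end IsTreeMagic

end ParentTree

/-! ### Commutation in the absence of disjoint swaps -/

/-- Expanding one as the sum of row `x` gives `U x a * U y b = U x a * U y b * U x a`, whose right
side is self-adjoint. -/
theorem IsMagicUnitary.commute_of_forall {V W X : Type*} [Fintype V] [Fintype W] [Ring X]
    [StarRing X] {U : Matrix W V X} (hU : IsMagicUnitary U) {x y : W} {a b : V}
    (h : ∀ c, c ≠ a → U x a * U y b * U x c = 0) : Commute (U x a) (U y b) := by
  classical
  have h1 : U x a * U y b = U x a * U y b * U x a := by
    conv_lhs => rw [← mul_one (U x a * U y b), ← hU.sum_row x, Finset.mul_sum]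
    exact Finset.sum_eq_single a (fun c _ hc => h c hc) (by simp)
  have h2 := congrArg star h1
  rw [StarMul.star_mul, StarMul.star_mul, StarMul.star_mul, hU.isSelfAdjoint, hU.isSelfAdjoint,
    ← mul_assoc] at h2
  exact h1.trans h2.symm

namespace ParentTree

variable {N N' X : Type*} [Fintype N] [Fintype N'] [Ring X] [StarRing X] [Algebra ℂ X]
  {T : ParentTree N} {T' : ParentTree N'} {U : Matrix N' N X}

namespace IsTreeMagic

/-- A subtree without swaps moves rigidly: in `U p q = ∑ c, U p q * U x c` only `c` below `q` can
contribute, and two such columns would produce a swap pair. -/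
theorem eq_of_not_exists_isSwapPair (hU : IsTreeMagic T' T U) {p x : N'} {q a : N}
    (h : Lift T' T p q x a) (hne : U x a ≠ 0)
    (hs : ¬ ∃ s t, T.IsSwapPair s t ∧ T.Desc q s ∧ T.Desc q t) : U p q = U x a := by
  classical
  rw [← hU.lift_mul h]
  conv_lhs => rw [← mul_one (U p q), ← hU.sum_row x, Finset.mul_sum]
  refine Finset.sum_eq_single a (fun c _ hc => ?_) (by simp)
  by_contra h0
  have hxc : U x c ≠ 0 := right_ne_zero_of_mul h0
  obtain ⟨c', h1, -⟩ := hU.exists_lift h c hxc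
  have : q = c' := by
    by_contra hqc
    rw [← hU.lift_mul h1, ← mul_assoc, hU.row_orthogonal _ _ _ hqc, zero_mul] at h0
    exact h0 rfl
  subst this
  exact hs (hU.exists_isSwapPair h c h1 hne hxc hc.symm)

/-- Three siblings which exhaust their isomorphism type are permuted by commuting projections. -/
theorem mul_mul_eq_zero_of_three (hU : IsTreeMagic T' T U) {p x y : N'} {q a b c : N}
    (hx : x ∈ T'.children p) (hy : y ∈ T'.children p) (ha : a ∈ T.children q)
    (hb : b ∈ T.children q) (hc : c ∈ T.children q) (hxy : x ≠ y) (hab : a ≠ b) (hac : a ≠ c)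
    (hbc : b ≠ c) (hyb : U y b ≠ 0)
    (h3 : ∀ e ∈ T.children q, T.type e = T.type b → e = a ∨ e = b ∨ e = c) :
    U x a * U y b * U x c = 0 := by
  classical
  obtain ⟨hx0, hxp⟩ := mem_children.1 hx
  obtain ⟨hy0, hyp⟩ := mem_children.1 hy
  obtain ⟨hc0, hcp⟩ := mem_children.1 hc
  have hsum : U y a + U y b + U y c = U p q := by
    rw [← hyp, ← hU.sum_children_right y hy0 q, ← Finset.sum_subset
      (s₁ := {a, b, c}) (by
        intro e he
        simp only [Finset.mem_insert, Finset.mem_singleton] at he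
        rcases he with rfl | rfl | rfl <;> assumption)]
    · rw [Finset.sum_insert (by simp [hab, hac]), Finset.sum_insert (by simp [hbc]),
        Finset.sum_singleton, add_assoc]
    · intro e he hne
      by_contra h0
      refine hne ?_
      simp only [Finset.mem_insert, Finset.mem_singleton]
      exact h3 e he (by rw [← hU.type_eq y e h0, hU.type_eq y b hyb])
  have hl : Lift T' T p q x c := .step hx0 hc0 (by rw [hxp, hcp]; exact .refl)
  -- Each term of this expression vanishes between `U x a` and `U x c`; the first does because `U p
  -- q` is absorbed by `U x c`.
  have e : U y b = U p q - U y a - U y c := by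
    rw [← hsum]
    abel
  rw [e, mul_sub, mul_sub, hU.col_orthogonal x a y hxy, sub_mul, sub_mul, mul_assoc (U x a) (U y c),
    hU.col_orthogonal y c x hxy.symm, mul_assoc, hU.lift_mul hl, hU.row_orthogonal _ _ _ hac]
  simp

/-- Noncommutation yields columns `c ≠ a` for row `x` and `d ≠ b` for row `y`. At the level of
children of `q`, either `c' = a'` and there is a swap inside the subtree of `a'`, or `a'` and `c'`
form a swap pair; likewise for `b'` and `d'`. All combinations give disjoint swaps, except possibly
`c' = d'` different from both `a'` and `b'`. -/
theorem commute_of_distinct_children (hU : IsTreeMagic T' T U) (hT : ¬ T.HasDisjointSwaps)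
    {p x' y' x y : N'} {q a' b' a b : N}
    (hx' : x' ∈ T'.children p) (hy' : y' ∈ T'.children p) (ha' : a' ∈ T.children q)
    (hb' : b' ∈ T.children q) (ha : Lift T' T x' a' x a) (hb : Lift T' T y' b' y b)
    (hxy : x' ≠ y') (hab : a' ≠ b') : Commute (U x a) (U y b) := by
  by_contra hcomm
  obtain ⟨c, hca, hc⟩ : ∃ c, c ≠ a ∧ U x a * U y b * U x c ≠ 0 := by
    by_contra! h
    exact hcomm (hU.commute_of_forall h)
  obtain ⟨d, hdb, hd⟩ : ∃ d, d ≠ b ∧ U y b * U x a * U y d ≠ 0 := by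
    by_contra! h
    exact hcomm (hU.commute_of_forall h).symm
  have hxa : U x a ≠ 0 := left_ne_zero_of_mul (left_ne_zero_of_mul hc)
  have hyb : U y b ≠ 0 := left_ne_zero_of_mul (left_ne_zero_of_mul hd)
  have hxc : U x c ≠ 0 := right_ne_zero_of_mul hc
  have hyd : U y d ≠ 0 := right_ne_zero_of_mul hd
  have hx'a' : U x' a' ≠ 0 := fun h0 => hxa (by rw [← hU.lift_mul ha, h0, zero_mul])
  have hy'b' : U y' b' ≠ 0 := fun h0 => hyb (by rw [← hU.lift_mul hb, h0, zero_mul])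
  obtain ⟨c', hc', hlc, hxc', hcb⟩ := hU.exists_lift_of_mul_ne_zero hx' hy' hb' ha hb hxy
    (by rw [mul_assoc] at hc; exact right_ne_zero_of_mul hc)
  obtain ⟨d', hd', hld, hyd', hda⟩ := hU.exists_lift_of_mul_ne_zero hy' hx' ha' hb ha hxy.symm
    (by rw [mul_assoc] at hd; exact right_ne_zero_of_mul hd)
  have swap_of : ∀ {e f}, e ∈ T.children q → f ∈ T.children q → e ≠ f → T.type e = T.type f →
      T.IsSwapPair e f := fun he hf hef ht =>
    ⟨(mem_children.1 he).1, (mem_children.1 hf).1, hef,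
      (mem_children.1 he).2.trans (mem_children.1 hf).2.symm, ht⟩
  have hta : T'.type x' = T.type a' := hU.type_eq _ _ hx'a'
  have htb : T'.type y' = T.type b' := hU.type_eq _ _ hy'b'
  have htc : T'.type x' = T.type c' := hU.type_eq _ _ hxc'
  have htd : T'.type y' = T.type d' := hU.type_eq _ _ hyd'
  have disj : ∀ {e f z}, e ∈ T.children q → f ∈ T.children q → e ≠ f → T.Desc e z →
      ¬ T.Desc f z := fun he hf hef h h' => hef (eq_of_desc_of_desc he hf h h')
  -- a swap below one child is disjoint from a swap of two other children
  have in_out : ∀ {e f g s t}, e ∈ T.children q → f ∈ T.children q → g ∈ T.children q →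
      e ≠ f → e ≠ g → f ≠ g → T.type f = T.type g → T.IsSwapPair s t → T.Desc e s →
      T.Desc e t → False := by
    intro e f g s t he hf hg hef heg hfg ht hst hs ht'
    refine hT ⟨s, t, f, g, hst, swap_of hf hg hfg ht, fun z hz hz' => ?_⟩
    have hez : T.Desc e z := hz.elim hs.trans ht'.trans
    exact hz'.elim (disj he hf hef hez) (disj he hg heg hez)
  have ins : ∀ {x' a' x a c}, Lift T' T x' a' x a → Lift T' T x' a' x c → U x a ≠ 0 →
      U x c ≠ 0 → c ≠ a → ∃ s t, T.IsSwapPair s t ∧ T.Desc a' s ∧ T.Desc a' t :=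
    fun h h' h1 h2 hne => hU.exists_isSwapPair h _ h' h1 h2 hne.symm
  by_cases hca' : c' = a'
  · subst hca'
    obtain ⟨s, t, hst, hs, ht⟩ := ins ha hlc hxa hxc hca
    by_cases hdb' : d' = b'
    · subst hdb'
      obtain ⟨s', t', hst', hs', ht'⟩ := ins hb hld hyb hyd hdb
      refine hT ⟨s, t, s', t', hst, hst', fun z hz hz' => ?_⟩
      exact disj ha' hb' hab (hz.elim hs.trans ht.trans) (hz'.elim hs'.trans ht'.trans)
    · exact in_out ha' hb' hd' hab hda.symm (Ne.symm hdb') (htb.symm.trans htd) hst hs ht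
  · by_cases hdb' : d' = b'
    · subst hdb'
      obtain ⟨s', t', hst', hs', ht'⟩ := ins hb hld hyb hyd hdb
      exact in_out hb' ha' hc' hab.symm hcb.symm (Ne.symm hca') (hta.symm.trans htc) hst' hs' ht'
    · have four : ∀ {e f g h}, e ∈ T.children q → f ∈ T.children q → g ∈ T.children q →
          h ∈ T.children q → e ≠ f → e ≠ g → e ≠ h → f ≠ g → f ≠ h → g ≠ h →
          T.type e = T.type f → T.type g = T.type h → False := by
        intro e f g h he hf hg hh hef heg heh hfg hfh hgh t1 t2
        refine hT ⟨e, f, g, h, swap_of he hf hef t1, swap_of hg hh hgh t2, fun z hz hz' => ?_⟩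
        rcases hz with hz | hz
        · exact hz'.elim (disj he hg heg hz) (disj he hh heh hz)
        · exact hz'.elim (disj hf hg hfg hz) (disj hf hh hfh hz)
      -- If `c' = d'`, the three children have one type. A fourth child of that type, or a swap
      -- inside `a'` or `b'`, would give disjoint swaps, so the entries at `(x, a)` and `(y, b)`
      -- equal those at `(x', a')` and `(y', b')`, and the lemma on three siblings applies.
      by_cases hcd : c' = d'
      · subst hcd
        have tab : T.type a' = T.type b' := by rw [← hta, htc, ← htd, htb]
        have rigid_a : ¬ ∃ s t, T.IsSwapPair s t ∧ T.Desc a' s ∧ T.Desc a' t := by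
          rintro ⟨s, t, hst, hs, ht⟩
          exact in_out ha' hb' hc' hab (Ne.symm hca') hcb.symm (htb.symm.trans htd) hst hs ht
        have rigid_b : ¬ ∃ s t, T.IsSwapPair s t ∧ T.Desc b' s ∧ T.Desc b' t := by
          rintro ⟨s, t, hst, hs, ht⟩
          exact in_out hb' ha' hc' hab.symm hcb.symm (Ne.symm hca') (hta.symm.trans htc) hst hs ht
        rw [← hU.eq_of_not_exists_isSwapPair ha hxa rigid_a,
          ← hU.eq_of_not_exists_isSwapPair hb hyb rigid_b, ← hU.lift_mul hlc, ← mul_assoc,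
          hU.mul_mul_eq_zero_of_three hx' hy' ha' hb' hc' hxy hab (Ne.symm hca') hcb.symm hy'b',
          zero_mul] at hc
        · exact hc rfl
        · intro e he hte
          by_contra! hne
          exact four ha' hc' hb' he (Ne.symm hca') hab hne.1.symm hcb hne.2.2.symm hne.2.1.symm
            (hta.symm.trans htc) hte.symm
      · exact four ha' hc' hb' hd' (Ne.symm hca') hab hda.symm hcb hcd (Ne.symm hdb')
          (hta.symm.trans htc) (htb.symm.trans htd)

/-- Follow both descents from `(p, q)` while they agree. If one stops, its entry dominates the
other; if they part in just one coordinate, orthogonality kills both products. -/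
theorem commute_of_lift (hU : IsTreeMagic T' T U) (hT : ¬ T.HasDisjointSwaps) (p : N') :
    ∀ {q a b x y}, Lift T' T p q x a → Lift T' T p q y b → Commute (U x a) (U y b) := by
  induction hn : T'.height p using Nat.strong_induction_on generalizing p with
  | _ n ih =>
    subst hn
    intro q a b x y ha hb
    rcases ha.eq_or_exists with ⟨rfl, rfl⟩ | ⟨x', hx', a', ha', hxa⟩
    · exact (hU.lift_mul hb).trans (hU.mul_lift hb).symm
    rcases hb.eq_or_exists with ⟨rfl, rfl⟩ | ⟨y', hy', b', hb', hyb⟩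
    · exact (hU.mul_lift ha).trans (hU.lift_mul ha).symm
    have zero : U x' a' * U y' b' = 0 → Commute (U x a) (U y b) := by
      intro h0
      have h0' : U y' b' * U x' a' = 0 := by rw [← hU.star_mul_apply, h0, star_zero]
      have e1 : U x a * U y b = 0 := by
        rw [← hU.mul_lift hxa, ← hU.lift_mul hyb, ← mul_assoc, mul_assoc (U x a), h0, mul_zero,
          zero_mul]
      have e2 : U y b * U x a = 0 := by
        rw [← hU.mul_lift hyb, ← hU.lift_mul hxa, ← mul_assoc, mul_assoc (U y b), h0', mul_zero,
          zero_mul]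
      exact e1.trans e2.symm
    by_cases hxy : x' = y'
    · subst hxy
      by_cases hab : a' = b'
      · subst hab
        exact ih _ (height_lt hx') x' rfl hxa hyb
      · exact zero (hU.row_orthogonal _ _ _ hab)
    · by_cases hab : a' = b'
      · subst hab
        exact zero (hU.col_orthogonal _ _ _ hxy)
      · exact hU.commute_of_distinct_children hT hx' hy' ha' hb' hxa hyb hxy hab

/-- If there are no disjoint swaps, the entries of a magic unitary between rooted trees commute. -/
theorem commute (hU : IsTreeMagic T' T U) (hT : ¬ T.HasDisjointSwaps) (x y : N') (a b : N) :
    Commute (U x a) (U y b) := by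
  by_cases hxa : U x a = 0
  · rw [hxa]
    exact Commute.zero_left _
  by_cases hyb : U y b = 0
  · rw [hyb]
    exact Commute.zero_right _
  exact hU.commute_of_lift hT _ (hU.lift_root x a hxa) (hU.lift_root y b hyb)

end IsTreeMagic

end ParentTree

/-! ### The rooted tree of a centroid rooted graph -/

namespace SimpleGraph

variable {V : Type*} [Fintype V] {G : SimpleGraph V}

open Classical in
/-- The parent of a vertex, if there is one. -/
noncomputable def parent (G : SimpleGraph V) (v : V) : Option V :=
  if h : ∃ p, G.IsParent p v then some h.choose else none

theorem parent_eq_none_iff {v : V} : G.parent v = none ↔ ¬ ∃ p, G.IsParent p v := by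
  unfold parent
  split_ifs with h <;> simp [h]

namespace IsCentroidRooted

variable (hG : G.IsCentroidRooted)
include hG

theorem parent_eq_some_iff {v p : V} : G.parent v = some p ↔ G.IsParent p v := by
  unfold parent
  split_ifs with h
  · rw [Option.some_inj]
    exact ⟨fun e => e ▸ h.choose_spec, fun h' => hG.parent_unique h.choose_spec h'⟩
  · simp only [false_iff]
    exact fun h' => h ⟨p, h'⟩

theorem parent_eq_of_isSibling {v w : V} (h : G.IsSibling v w) : G.parent v = G.parent w := by
  have key : ∀ p, G.parent v = some p ↔ G.parent w = some p := fun p => by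
    rw [hG.parent_eq_some_iff, hG.parent_eq_some_iff]
    exact ⟨hG.parent_of_sibling h, hG.parent_of_sibling h.symm⟩
  exact Option.ext key

/-- The equivalence relation of being siblings. -/
def siblingSetoid : Setoid V where
  r := G.IsSibling
  iseqv := ⟨isSibling_refl, IsSibling.symm, fun h h' => hG.sibling_trans h h'⟩

/-- The classes of siblings. -/
def SiblingClass : Type _ := Quotient hG.siblingSetoid

noncomputable instance : Fintype hG.SiblingClass :=
  letI : Finite hG.SiblingClass := inferInstanceAs (Finite (Quotient hG.siblingSetoid))
  Fintype.ofFinite _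

/-- The class of a vertex. -/
def cls (v : V) : hG.SiblingClass := Quotient.mk hG.siblingSetoid v

theorem cls_surjective : Function.Surjective hG.cls := Quotient.mk_surjective

theorem cls_eq_iff {v w : V} : hG.cls v = hG.cls w ↔ G.IsSibling v w :=
  Quotient.eq (r := hG.siblingSetoid)

/-- The common parent of a class of siblings. -/
noncomputable def classParent : hG.SiblingClass → Option V :=
  Quotient.lift (s := hG.siblingSetoid) G.parent fun _ _ h => hG.parent_eq_of_isSibling h

theorem classParent_cls (v : V) : hG.classParent (hG.cls v) = G.parent v := rfl

/-- The nodes of the rooted tree attached to `G`: a root, the vertices, and the classes of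
siblings. -/
abbrev Node : Type _ := Option (V ⊕ hG.SiblingClass)

/-- The parent of a vertex is its class; the parent of a class is the common parent of its
members, or the root. -/
noncomputable def nodePar : hG.Node → hG.Node
  | none => none
  | some (Sum.inl v) => some (Sum.inr (hG.cls v))
  | some (Sum.inr q) => (hG.classParent q).map Sum.inl

/-- A rank which increases from parents to children. -/
noncomputable def nodeRank : hG.Node → ℕ
  | none => 0
  | some (Sum.inl v) => 2 * G.distSum v + 2
  -- As `distSum` drops strictly at a parent, doubling leaves room for a class between its parent
  -- and its members. The default `1` puts a parentless class between the root and its members.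
  | some (Sum.inr q) => (hG.classParent q).elim 1 fun p => 2 * G.distSum p + 3

/-- The rooted tree attached to `G`. -/
noncomputable def tree : ParentTree hG.Node where
  root := none
  par := hG.nodePar
  rank := hG.nodeRank
  rank_par_lt y hy := by
    rcases y with _ | v | q
    · exact absurd rfl hy
    · simp only [nodePar, nodeRank, classParent_cls]
      rcases h : G.parent v with _ | p
      · simp
      · have := (hG.parent_eq_some_iff.1 h).distSum_lt
        simp only [Option.elim_some]
        omega
    · simp only [nodePar, nodeRank]
      rcases h : hG.classParent q with _ | p <;> simp

end IsCentroidRooted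

end SimpleGraph

/-! ### Extending a magic unitary to the trees -/

namespace Compatible

open SimpleGraph

variable {V W X : Type*} [Fintype V] [Fintype W] [Ring X] [StarRing X]
  {U : Matrix W V X} {G : SimpleGraph V} {H : SimpleGraph W}

open Classical in
/-- The extension of `U` to the nodes of the rooted trees. -/
noncomputable def nodeMatrix (U : Matrix W V X) (hG : G.IsCentroidRooted)
    (hH : H.IsCentroidRooted) : Matrix hH.Node hG.Node X
  | none, none => 1
  | some (Sum.inl x), some (Sum.inl a) => U x a
  | some (Sum.inr q), some (Sum.inr r) =>
    -- The choice of representative does not matter for compatible `U`, by `sum_cls_eq`.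
    ∑ b, if hG.cls b = r then U (hH.cls_surjective q).choose b else 0
  | _, _ => 0

variable [Algebra ℂ X] (hU : IsMagicUnitary U) (hA : Compatible U H.Adj G.Adj)
  (hG : G.IsCentroidRooted) (hH : H.IsCentroidRooted)
include hU hA

-- Insert the column sum of `b` on one side and the row sum of `y` on the other; in a nonzero
-- product `U y b' * U y' b`, the columns are siblings if and only if the rows are.
open Classical in
theorem sum_cls_eq (y : W) (b : V) :
    (∑ b', if hG.cls b' = hG.cls b then U y b' else 0) =
      ∑ y', if hH.cls y' = hH.cls y then U y' b else 0 := by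
  have hS := isSibling hU hA
  have key : ∀ y' b', (if hG.cls b' = hG.cls b then U y b' * U y' b else 0) =
      if hH.cls y' = hH.cls y then U y b' * U y' b else 0 := by
    intro y' b'
    by_cases h : U y b' * U y' b = 0
    · simp [h]
    have : hG.cls b' = hG.cls b ↔ hH.cls y' = hH.cls y := by
      rw [hG.cls_eq_iff, eq_comm, hH.cls_eq_iff, hS h]
    simp only [this]
  calc (∑ b', if hG.cls b' = hG.cls b then U y b' else 0)
      = ∑ b', ∑ y', if hG.cls b' = hG.cls b then U y b' * U y' b else 0 := by
        refine Finset.sum_congr rfl fun b' _ => ?_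
        split_ifs
        · rw [← Finset.mul_sum, hU.sum_col, mul_one]
        · simp
    _ = ∑ y', ∑ b', if hH.cls y' = hH.cls y then U y b' * U y' b else 0 := by
        rw [Finset.sum_comm]
        exact Finset.sum_congr rfl fun y' _ => Finset.sum_congr rfl fun b' _ => key y' b'
    _ = _ := by
        refine Finset.sum_congr rfl fun y' _ => ?_
        split_ifs
        · rw [← Finset.sum_mul, hU.sum_row, one_mul]
        · simp

open Classical in
theorem nodeMatrix_cls_right (q : hH.SiblingClass) (b : V) :
    nodeMatrix U hG hH (some (Sum.inr q)) (some (Sum.inr (hG.cls b))) =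
      ∑ y', if hH.cls y' = q then U y' b else 0 := by
  conv_rhs => rw [← (hH.cls_surjective q).choose_spec]
  exact sum_cls_eq hU hA hG hH _ b

open Classical in
theorem nodeMatrix_cls_left (y : W) (r : hG.SiblingClass) :
    nodeMatrix U hG hH (some (Sum.inr (hH.cls y))) (some (Sum.inr r)) =
      ∑ b, if hG.cls b = r then U y b else 0 := by
  obtain ⟨b, rfl⟩ := hG.cls_surjective r
  rw [nodeMatrix_cls_right hU hA, ← sum_cls_eq hU hA]

/-- Reduces all column statements to row statements. -/
theorem nodeMatrix_transpose :
    nodeMatrix U.transpose hH hG = (nodeMatrix U hG hH).transpose := by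
  ext y x
  rcases x with _ | x | q <;> rcases y with _ | y | r <;> try rfl
  obtain ⟨y, rfl⟩ := hG.cls_surjective r
  rw [Matrix.transpose_apply, nodeMatrix_cls_right hU hA,
    nodeMatrix_cls_left hU.transpose hA.transpose]
  rfl

-- If `p` is the parent of `y`, then `U p q' * U y b` vanishes unless `q'` is the parent of `b`. So
-- `U p q * U y b` is `U y b` or zero; sum over `b`.
include hG hH in
open Classical in
theorem sum_parent_some (y : W) (q : V) :
    (∑ b, if G.parent b = some q then U y b else 0) = (H.parent y).elim 0 fun p => U p q := by
  have hP := isParent hU hA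
  rcases h : H.parent y with _ | p
  · refine Finset.sum_eq_zero fun b _ => ?_
    split_ifs with hb
    · by_contra h0
      exact parent_eq_none_iff.1 h ((exists_isParent hU hA h0).2 ⟨q, hG.parent_eq_some_iff.1 hb⟩)
    · rfl
  · have hp := hH.parent_eq_some_iff.1 h
    have key : ∀ b, (if G.parent b = some q then U y b else 0) = U p q * U y b := by
      intro b
      have h1 : ∀ q', G.parent b ≠ some q' → U p q' * U y b = 0 := by
        intro q' hb
        by_contra h0
        exact hb (hG.parent_eq_some_iff.2 ((hP h0).mp hp))
      split_ifs with hb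
      · symm
        calc U p q * U y b = ∑ q', U p q' * U y b := by
              refine (Finset.sum_eq_single q (fun q' _ hq' => h1 q' ?_) (by simp)).symm
              rw [hb, Ne, Option.some_inj]
              exact hq'.symm
          _ = U y b := by rw [← Finset.sum_mul, hU.sum_row, one_mul]
      · exact (h1 q hb).symm
    simp only [key, ← Finset.mul_sum, hU.sum_row, mul_one, Option.elim_some]

open Classical in
theorem sum_parent_none (y : W) :
    (∑ b, if G.parent b = none then U y b else 0) = (H.parent y).elim 1 fun _ => 0 := by
  have key : ∀ b, U y b ≠ 0 → (G.parent b = none ↔ H.parent y = none) := by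
    intro b hb
    rw [parent_eq_none_iff, parent_eq_none_iff, exists_isParent hU hA hb]
  rcases h : H.parent y with _ | p
  · rw [Option.elim_none, ← hU.sum_row y]
    refine Finset.sum_congr rfl fun b _ => ?_
    by_cases hb : U y b = 0
    · simp [hb]
    · rw [if_pos ((key b hb).2 h)]
  · refine Finset.sum_eq_zero fun b _ => ?_
    by_cases hb : U y b = 0
    · simp [hb]
    · rw [if_neg]
      rw [key b hb, h]
      simp

theorem nodeMatrix_row_orthogonal (i : hH.Node) (j k : hG.Node) (hjk : j ≠ k) :
    nodeMatrix U hG hH i j * nodeMatrix U hG hH i k = 0 := by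
  classical
  rcases i with _ | i | q <;> rcases j with _ | j | r <;> rcases k with _ | k | s <;>
    try first
      | exact absurd rfl hjk
      | exact mul_zero _
      | exact zero_mul _
  · exact hU.row_orthogonal _ _ _ fun e => hjk (e ▸ rfl)
  · obtain ⟨y, rfl⟩ := hH.cls_surjective q
    rw [nodeMatrix_cls_left hU hA, nodeMatrix_cls_left hU hA, Finset.sum_mul_sum]
    refine Finset.sum_eq_zero fun b _ => Finset.sum_eq_zero fun c _ => ?_
    split_ifs with h1 h2
    · refine hU.row_orthogonal _ _ _ ?_
      rintro rfl
      exact hjk (by rw [← h1, ← h2])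
    all_goals simp

theorem nodeMatrix_sum_row (i : hH.Node) : ∑ j, nodeMatrix U hG hH i j = 1 := by
  classical
  rw [Fintype.sum_option, Fintype.sum_sum_type]
  rcases i with _ | i | q
  · simp [nodeMatrix]
  · simp [nodeMatrix, hU.sum_row]
  · obtain ⟨y, rfl⟩ := hH.cls_surjective q
    simp only [nodeMatrix_cls_left hU hA]
    rw [Finset.sum_comm]
    simp [nodeMatrix, hU.sum_row]

theorem nodeMatrix_sum_children (y : hH.Node) (hy : y ≠ none) (a : hG.Node) :
    ∑ b ∈ hG.tree.children a, nodeMatrix U hG hH y b = nodeMatrix U hG hH (hH.nodePar y) a := by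
  classical
  rw [ParentTree.children, Finset.sum_filter, Fintype.sum_option, Fintype.sum_sum_type]
  have e0 : hG.tree.root = none := rfl
  have e1 : ∀ b, hG.tree.par (some (Sum.inl b)) = some (Sum.inr (hG.cls b)) := fun _ => rfl
  have e2 : ∀ r, hG.tree.par (some (Sum.inr r)) = (hG.classParent r).map Sum.inl := fun _ => rfl
  simp only [e0, e1, e2, ne_eq, not_true_eq_false, false_and, if_false, zero_add, reduceCtorEq,
    not_false_eq_true, true_and]
  rcases y with _ | y | q
  · exact absurd rfl hy
  · have e3 : ∀ r, nodeMatrix U hG hH (some (Sum.inl y)) (some (Sum.inr r)) = 0 := fun _ => rfl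
    simp only [e3, ite_self, Finset.sum_const_zero, add_zero, IsCentroidRooted.nodePar]
    rcases a with _ | a | r
    · simp [nodeMatrix]
    · simp [nodeMatrix]
    · rw [nodeMatrix_cls_left hU hA]
      simp [nodeMatrix]
  · obtain ⟨y, rfl⟩ := hH.cls_surjective q
    have e3 : ∀ b, nodeMatrix U hG hH (some (Sum.inr (hH.cls y))) (some (Sum.inl b)) = 0 :=
      fun _ => rfl
    -- A sum over sibling classes unfolds to a sum over vertices, since members share the parent of
    -- their class.
    have e4 : ∀ P : Option V → Prop, (∑ r, if P (hG.classParent r) then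
        nodeMatrix U hG hH (some (Sum.inr (hH.cls y))) (some (Sum.inr r)) else 0) =
        ∑ b, if P (G.parent b) then U y b else 0 := by
      intro P
      have e5 : ∀ r, (if P (hG.classParent r) then
          nodeMatrix U hG hH (some (Sum.inr (hH.cls y))) (some (Sum.inr r)) else 0) =
          ∑ b, if hG.cls b = r then (if P (hG.classParent r) then U y b else 0) else 0 := by
        intro r
        rw [nodeMatrix_cls_left hU hA]
        split_ifs <;> simp
      simp only [e5]
      rw [Finset.sum_comm]
      refine Finset.sum_congr rfl fun b _ => ?_
      rw [Finset.sum_ite_eq, if_pos (Finset.mem_univ _), hG.classParent_cls]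
    simp only [e3, ite_self, Finset.sum_const_zero, zero_add, IsCentroidRooted.nodePar,
      hH.classParent_cls]
    have e5 := e4 fun o => o.map Sum.inl = a
    refine Eq.trans ?_ (e5.trans ?_)
    · congr!
    rcases a with _ | a | r
    · have h := sum_parent_none hU hA y
      simp only [Option.map_eq_none_iff]
      refine Eq.trans ?_ (h.trans ?_)
      · congr!
      · rcases H.parent y <;> rfl
    · have : ∀ o : Option V, o.map (Sum.inl (β := hG.SiblingClass)) = some (Sum.inl a) ↔
          o = some a := fun o => by cases o <;> simp
      have h := sum_parent_some hU hA hG hH y a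
      simp only [this]
      refine Eq.trans ?_ (h.trans ?_)
      · congr!
      · rcases H.parent y <;> rfl
    · have : ∀ o : Option V, ¬ o.map (Sum.inl (β := hG.SiblingClass)) = some (Sum.inr r) :=
        fun o => by cases o <;> simp
      simp only [this, if_false, Finset.sum_const_zero]
      rcases H.parent y <;> rfl

theorem isTreeMagic_nodeMatrix :
    ParentTree.IsTreeMagic hH.tree hG.tree (nodeMatrix U hG hH) where
  isSelfAdjoint i j := by
    classical
    rcases i with _ | i | q <;> rcases j with _ | j | r <;>
      try first
        | exact star_zero _
        | exact star_one _
    · exact hU.isSelfAdjoint _ _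
    · obtain ⟨y, rfl⟩ := hH.cls_surjective q
      rw [nodeMatrix_cls_left hU hA, star_sum]
      refine Finset.sum_congr rfl fun b _ => ?_
      split_ifs
      · exact hU.isSelfAdjoint _ _
      · exact star_zero _
  idem i j := by
    classical
    have h1 := nodeMatrix_sum_row hU hA hG hH i
    conv_rhs => rw [← mul_one (nodeMatrix U hG hH i j), ← h1, Finset.mul_sum]
    exact (Finset.sum_eq_single j
      (fun k _ hk => nodeMatrix_row_orthogonal hU hA hG hH i j k hk.symm) (by simp)).symm
  row_orthogonal := nodeMatrix_row_orthogonal hU hA hG hH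
  col_orthogonal i j k h := by
    have := nodeMatrix_row_orthogonal hU.transpose hA.transpose hH hG j i k h
    rwa [nodeMatrix_transpose hU hA] at this
  sum_row := nodeMatrix_sum_row hU hA hG hH
  sum_col j := by
    have := nodeMatrix_sum_row hU.transpose hA.transpose hH hG j
    rwa [nodeMatrix_transpose hU hA] at this
  root_root := rfl
  sum_children_right := nodeMatrix_sum_children hU hA hG hH
  sum_children_left b hb x := by
    have := nodeMatrix_sum_children hU.transpose hA.transpose hH hG b hb x
    rwa [nodeMatrix_transpose hU hA] at this

end Compatible

/-! ### From tree embeddings to graph isomorphisms -/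

namespace SimpleGraph.IsCentroidRooted

open ParentTree

variable {V W : Type*} [Fintype V] [Fintype W] {G : SimpleGraph V} {H : SimpleGraph W}
  {hG : G.IsCentroidRooted} {hH : H.IsCentroidRooted} {Φ : hH.Node → hG.Node}

/-- The three kinds of nodes: the root, vertices and classes. -/
def kind (hG : G.IsCentroidRooted) : hG.Node → ℕ
  | none => 0
  | some (Sum.inl _) => 1
  | some (Sum.inr _) => 2

theorem kind_par (hG : G.IsCentroidRooted) {z : hG.Node} (hz : z ≠ none) :
    (hG.kind z = 1 ∧ hG.kind (hG.tree.par z) = 2) ∨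
      (hG.kind z = 2 ∧ hG.kind (hG.tree.par z) ≠ 2) := by
  rcases z with _ | v | q
  · exact absurd rfl hz
  · exact Or.inl ⟨rfl, rfl⟩
  · refine Or.inr ⟨rfl, ?_⟩
    change hG.kind ((hG.classParent q).map Sum.inl) ≠ 2
    rcases hG.classParent q <;> simp [kind]

/-- The kind of a node other than the root is determined by that of its parent, by `kind_par`, so it
propagates from the root. -/
theorem kind_map (hΦ : IsEmbedding hH.tree hG.tree Φ) (y : hH.Node) :
    hG.kind (Φ y) = hH.kind y := by
  refine par_induction (T' := hH.tree) (p := fun y => hG.kind (Φ y) = hH.kind y) ?_ ?_ y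
  · rw [hΦ.map_root]
    rfl
  · intro y hy ih
    rw [hΦ.map_par y hy] at ih
    have hy' : Φ y ≠ none := fun e => hy (hΦ.injective (e.trans hΦ.map_root.symm))
    have h1 := kind_par hH hy
    have h2 := kind_par hG hy'
    omega

theorem exists_vertex_map (hΦ : IsEmbedding hH.tree hG.tree Φ) :
    ∃ φ : W → V, ∀ x, Φ (some (Sum.inl x)) = some (Sum.inl (φ x)) := by
  have : ∀ x, ∃ v, Φ (some (Sum.inl x)) = some (Sum.inl v) := by
    intro x
    have h := kind_map hΦ (some (Sum.inl x))
    rcases hz : Φ (some (Sum.inl x)) with _ | v | q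
    · simp [hz, kind] at h
    · exact ⟨v, rfl⟩
    · simp [hz, kind] at h
  exact ⟨fun x => (this x).choose, fun x => (this x).choose_spec⟩

theorem par_vertex_eq_iff (hG : G.IsCentroidRooted) {v w : V} :
    hG.tree.par (some (Sum.inl v)) = hG.tree.par (some (Sum.inl w)) ↔ G.IsSibling v w := by
  rw [← hG.cls_eq_iff]
  exact ⟨fun h => Sum.inr_injective (Option.some_injective _ h), fun h =>
    congrArg (fun q => some (Sum.inr q)) h⟩

theorem par_par_vertex_eq_iff (hG : G.IsCentroidRooted) {v p : V} :
    hG.tree.par (hG.tree.par (some (Sum.inl v))) = some (Sum.inl p) ↔ G.IsParent p v := by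
  rw [← hG.parent_eq_some_iff]
  change (G.parent v).map Sum.inl = _ ↔ _
  rcases G.parent v <;> simp

/-- Siblings are vertices with the same tree parent and the parent of a vertex is its tree
grandparent; these two relations determine adjacency. -/
theorem adj_map_iff (hΦ : IsEmbedding hH.tree hG.tree Φ) {φ : W → V}
    (hφ : ∀ x, Φ (some (Sum.inl x)) = some (Sum.inl (φ x))) (x y : W) :
    G.Adj (φ x) (φ y) ↔ H.Adj x y := by
  have hne : ∀ x, some (Sum.inl x) ≠ hH.tree.root := fun x => Option.some_ne_none _
  have hne' : ∀ x, hH.tree.par (some (Sum.inl x)) ≠ hH.tree.root :=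
    fun x => Option.some_ne_none _
  have hS : ∀ x y, G.IsSibling (φ x) (φ y) ↔ H.IsSibling x y := by
    intro x y
    rw [← par_vertex_eq_iff hG, ← par_vertex_eq_iff hH, ← hφ, ← hφ, ← hΦ.map_par _ (hne x),
      ← hΦ.map_par _ (hne y), hΦ.injective.eq_iff]
  have hP : ∀ p x, G.IsParent (φ p) (φ x) ↔ H.IsParent p x := by
    intro p x
    rw [← par_par_vertex_eq_iff hG, ← par_par_vertex_eq_iff hH, ← hφ, ← hφ, ← hΦ.map_par _ (hne x),
      ← hΦ.map_par _ (hne' x), hΦ.injective.eq_iff]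
  have hinj : φ x = φ y ↔ x = y := by
    refine ⟨fun h => ?_, congrArg φ⟩
    have := hΦ.injective ((hφ x).trans ((congrArg (fun v => some (Sum.inl v)) h).trans (hφ y).symm))
    exact Sum.inl_injective (Option.some_injective _ this)
  rw [adj_iff_isParent_or_isSibling, adj_iff_isParent_or_isSibling, hS, hP, hP, Ne, Ne, hinj]

theorem exists_iso (hΦ : IsEmbedding hH.tree hG.tree Φ) (hc : Fintype.card W = Fintype.card V) :
    ∃ σ : H ≃g G, ∀ x, Φ (some (Sum.inl x)) = some (Sum.inl (σ x)) := by
  obtain ⟨φ, hφ⟩ := exists_vertex_map hΦ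
  have hinj : Function.Injective φ := by
    intro x y h
    have := hΦ.injective ((hφ x).trans ((congrArg (fun v => some (Sum.inl v)) h).trans (hφ y).symm))
    exact Sum.inl_injective (Option.some_injective _ this)
  have hbij := (Fintype.bijective_iff_injective_and_card φ).2 ⟨hinj, hc⟩
  exact ⟨⟨Equiv.ofBijective φ hbij, fun {x y} => adj_map_iff hΦ hφ x y⟩, hφ⟩

/-- An embedding that fixes every vertex fixes the classes, which are parents of vertices, and the
root. -/
theorem exists_ne_of_map_ne {hG : G.IsCentroidRooted} {Φ : hG.Node → hG.Node}
    (hΦ : IsEmbedding hG.tree hG.tree Φ) {σ : G ≃g G}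
    (hσ : ∀ x, Φ (some (Sum.inl x)) = some (Sum.inl (σ x))) {s : hG.Node} (hs : Φ s ≠ s) :
    ∃ v, σ v ≠ v := by
  by_contra! h
  refine hs ?_
  rcases s with _ | v | q
  · exact hΦ.map_root
  · rw [hσ, h]
  · obtain ⟨v, rfl⟩ := hG.cls_surjective q
    have := hΦ.map_par (some (Sum.inl v)) (Option.some_ne_none _)
    rwa [hσ, h] at this

theorem schmidtCriterion (hG : G.IsCentroidRooted) (h : hG.tree.HasDisjointSwaps) :
    G.SchmidtCriterion := by
  obtain ⟨s, t, s', t', hst, hst', hd⟩ := h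
  obtain ⟨Φ, hΦ, h1, h2⟩ := hst.exists_isEmbedding
  obtain ⟨Ψ, hΨ, h1', h2'⟩ := hst'.exists_isEmbedding
  obtain ⟨σ, hσ⟩ := exists_iso hΦ rfl
  obtain ⟨τ, hτ⟩ := exists_iso hΨ rfl
  refine ⟨σ, τ, exists_ne_of_map_ne hΦ hσ (s := s) (by rw [h1]; exact hst.ne.symm),
    exists_ne_of_map_ne hΨ hτ (s := s') (by rw [h1']; exact hst'.ne.symm), ?_⟩
  have mem : ∀ {Φ : hG.Node → hG.Node} {σ : G ≃g G} {s t : hG.Node}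
      (_ : ∀ x, Φ (some (Sum.inl x)) = some (Sum.inl (σ x)))
      (_ : ∀ y, ¬ hG.tree.Desc s y → ¬ hG.tree.Desc t y → Φ y = y) {v : V}, σ v ≠ v →
      hG.tree.Desc s (some (Sum.inl v)) ∨ hG.tree.Desc t (some (Sum.inl v)) := by
    intro Φ σ s t hσ hfix v hv
    by_contra! hn
    have := hfix _ hn.1 hn.2
    rw [hσ] at this
    exact hv (Sum.inl_injective (Option.some_injective _ this))
  rw [Set.disjoint_left]
  exact fun v hv hv' => hd _ (mem hσ h2 hv) (mem hτ h2' hv')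

end SimpleGraph.IsCentroidRooted

/-! ### Superrigidity, and commutativity without disjoint automorphisms -/

theorem QuantumIsomorphic.nonempty_iso {V W : Type*} [Fintype V] [Fintype W] {G : SimpleGraph V}
    {H : SimpleGraph W} (hG : G.IsBlockGraph) (h : QuantumIsomorphic G H) : Nonempty (H ≃g G) := by
  obtain ⟨X, _, _, U, hU, hUGH⟩ := h
  have hA := Compatible.adj hU hUGH
  have hG' := hG.isNeighborSeparating.isCentroidRooted
  have hH' := Compatible.isCentroidRooted hU hA hG'
  have hT := Compatible.isTreeMagic_nodeMatrix hU hA hG' hH'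
  obtain ⟨Φ, hΦ⟩ := ParentTree.exists_isEmbedding
    (hT.type_eq _ _ (by rw [hT.root_root]; exact one_ne_zero))
  obtain ⟨σ, -⟩ := SimpleGraph.IsCentroidRooted.exists_iso hΦ hU.card_eq
  exact ⟨σ⟩

namespace QuantumAut

variable {V : Type u} [Fintype V] {G : SimpleGraph V}

theorem mul_comm_of_commute (h : ∀ x y a b, Commute (U G x a) (U G y b)) (a b : A G) :
    a * b = b * a := by
  have gen : ∀ p : (V × V) ⊕ (V × V), ∃ x y, mk G (FreeStarAlgebra.ι p) = U G x y := by
    rintro (p | p)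
    · exact ⟨p.1, p.2, rfl⟩
    · refine ⟨p.1, p.2, ?_⟩
      have h1 := FreeStarAlgebra.star_ι (Sum.inl p)
      rw [Sum.swap_inl] at h1
      rw [← h1, mk_star]
      exact (isMagicUnitary_U G).isSelfAdjoint p.1 p.2
  have comm : ∀ c : A G, (∀ x y, Commute (U G x y) c) → ∀ d : A G, Commute d c := by
    intro c hc d
    obtain ⟨d, rfl⟩ := mk_surjective G d
    induction d using FreeStarAlgebra.induction with
    | h_scalar r =>
      rw [AlgHom.commutes]
      exact Algebra.commutes r c
    | h_gen p =>
      obtain ⟨x, y, e⟩ := gen p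
      rw [e]
      exact hc x y
    | h_mul a b ha hb =>
      rw [map_mul]
      exact ha.mul_left hb
    | h_add a b ha hb =>
      rw [map_add]
      exact ha.add_left hb
  exact comm b (fun x y => (comm _ (fun x' y' => h _ _ _ _) b).symm) a

end QuantumAut

theorem HasQuantumSymmetry.schmidtCriterion {V : Type*} [Fintype V] {G : SimpleGraph V}
    (hG : G.IsBlockGraph) (h : HasQuantumSymmetry G) : G.SchmidtCriterion := by
  by_contra hS
  have hU := QuantumAut.isMagicUnitary_U G
  have hA := Compatible.adj hU (QuantumAut.intertwines_U G)
  have hG' := hG.isNeighborSeparating.isCentroidRooted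
  have hT := Compatible.isTreeMagic_nodeMatrix hU hA hG' hG'
  exact h (QuantumAut.mul_comm_of_commute fun x y a b =>
    hT.commute (fun hd => hS (hG'.schmidtCriterion hd)) (some (Sum.inl x)) (some (Sum.inl y))
      (some (Sum.inl a)) (some (Sum.inl b)))

/-! ### Quantum symmetry from disjoint automorphisms -/

section TwoValued

variable {V X : Type*} [DecidableEq V] [Ring X]

/-- The matrix with the column of `y` supported on `y` and `ρ y`, with values `e y` and
`1 - e y`. -/
def twoValuedMatrix (ρ : V ≃ V) (e : V → X) : Matrix V V X :=
  fun x y => (if x = y then e y else 0) + (if x = ρ y then 1 - e y else 0)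

variable [Fintype V]

theorem isMagicUnitary_twoValuedMatrix [StarRing X] (ρ : V ≃ V) {e : V → X} (hs : ∀ y, star (e y) = e y)
    (he : ∀ y, e y * e y = e y) (hρ : ∀ y, e (ρ y) = e y) :
    IsMagicUnitary (twoValuedMatrix ρ e) where
  isSelfAdjoint x y := by
    unfold twoValuedMatrix
    split_ifs <;> simp [hs]
  idem x y := by
    unfold twoValuedMatrix
    split_ifs <;> simp [mul_sub, sub_mul, he]
  row_orthogonal x y z h := by
    have h1 : (if x = y then e y else 0) * (if x = z then e z else 0) = 0 := by
      split_ifs with a b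
      · exact absurd (a.symm.trans b) h
      all_goals simp
    have h2 : (if x = y then e y else 0) * (if x = ρ z then 1 - e z else 0) = 0 := by
      split_ifs with a b
      · rw [← a, b, hρ, mul_sub, mul_one, he, sub_self]
      all_goals simp
    have h3 : (if x = ρ y then 1 - e y else 0) * (if x = z then e z else 0) = 0 := by
      split_ifs with a b
      · rw [← b, a, hρ, sub_mul, one_mul, he, sub_self]
      all_goals simp
    have h4 : (if x = ρ y then 1 - e y else 0) * (if x = ρ z then 1 - e z else 0) = 0 := by
      split_ifs with a b
      · exact absurd (ρ.injective (a.symm.trans b)) h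
      all_goals simp
    rw [twoValuedMatrix, twoValuedMatrix, add_mul, mul_add, mul_add, h1, h2, h3, h4]
    simp
  col_orthogonal x y z h := by
    have h1 : (if x = y then e y else 0) * (if z = y then e y else 0) = 0 := by
      split_ifs with a b
      · exact absurd (a.trans b.symm) h
      all_goals simp
    have h2 : (if x = y then e y else 0) * (if z = ρ y then 1 - e y else 0) = 0 := by
      split_ifs
      · rw [mul_sub, mul_one, he, sub_self]
      all_goals simp
    have h3 : (if x = ρ y then 1 - e y else 0) * (if z = y then e y else 0) = 0 := by
      split_ifs
      · rw [sub_mul, one_mul, he, sub_self]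
      all_goals simp
    have h4 : (if x = ρ y then 1 - e y else 0) * (if z = ρ y then 1 - e y else 0) = 0 := by
      split_ifs with a b
      · exact absurd (a.trans b.symm) h
      all_goals simp
    rw [twoValuedMatrix, twoValuedMatrix, add_mul, mul_add, mul_add, h1, h2, h3, h4]
    simp
  sum_row x := by
    have : ∀ y, x = ρ y ↔ ρ.symm x = y := fun y => (Equiv.symm_apply_eq ρ).symm
    have h := hρ (ρ.symm x)
    rw [Equiv.apply_symm_apply] at h
    simp [twoValuedMatrix, Finset.sum_add_distrib, this, ← h]
  sum_col y := by
    simp [twoValuedMatrix, Finset.sum_add_distrib]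

/-- Where `e x = e z`, the relation holds because `ρ` is an automorphism. Otherwise `ρ` does not
affect the adjacency, and `e` and `1 - e` add up to one on both sides. -/
theorem intertwines_twoValuedMatrix {G : SimpleGraph V} (ρ : G ≃g G) {e : V → X} (hρ : ∀ y, e (ρ y) = e y)
    (hne : ∀ x z, e x ≠ e z → (G.Adj x (ρ z) ↔ G.Adj x z)) :
    Intertwines G G (twoValuedMatrix ρ.toEquiv e) := by
  classical
  ext x z
  have h := hρ (ρ.symm x)
  rw [RelIso.apply_symm_apply] at h
  have h1 : ∀ y, x = ρ y ↔ ρ.symm x = y := fun y => (Equiv.symm_apply_eq ρ.toEquiv).symm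
  have h2 : G.Adj (ρ.symm x) z ↔ G.Adj x (ρ z) := by
    rw [← ρ.map_adj_iff, RelIso.apply_symm_apply]
  have e1 : (twoValuedMatrix ρ.toEquiv e * G.adjMatrix X) x z =
      (if G.Adj x z then e x else 0) + if G.Adj x (ρ z) then 1 - e x else 0 := by
    have h3 : ∀ y, x = ρ.toEquiv y ↔ ρ.symm x = y := h1
    simp only [Matrix.mul_apply, twoValuedMatrix, add_mul, Finset.sum_add_distrib]
    simp only [h3, ite_mul, zero_mul, Finset.sum_ite_eq, Finset.mem_univ, if_true]
    simp only [SimpleGraph.adjMatrix_apply, mul_ite, mul_one, mul_zero, h2, ← h]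
  have e2 : (G.adjMatrix X * twoValuedMatrix ρ.toEquiv e) x z =
      (if G.Adj x z then e z else 0) + if G.Adj x (ρ z) then 1 - e z else 0 := by
    simp only [Matrix.mul_apply, twoValuedMatrix, mul_add, Finset.sum_add_distrib, mul_ite,
      mul_zero, Finset.sum_ite_eq', Finset.mem_univ, if_true, SimpleGraph.adjMatrix_apply, ite_mul,
      one_mul, zero_mul]
    rfl
  have e3 : (if G.Adj x z then e x else 0) + (if G.Adj x (ρ z) then 1 - e x else 0) =
      (if G.Adj x z then e z else 0) + if G.Adj x (ρ z) then 1 - e z else 0 := by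
    by_cases hxz : e x = e z
    · rw [hxz]
    · simp only [hne x z hxz]
      split_ifs <;> simp
  convert e1.trans (e3.trans e2.symm) using 2

end TwoValued

theorem SimpleGraph.SchmidtCriterion.hasQuantumSymmetry {V : Type*} [Fintype V]
    {G : SimpleGraph V} (h : G.SchmidtCriterion) : HasQuantumSymmetry G := by
  classical
  obtain ⟨σ, τ, ⟨v, hv⟩, ⟨w, hw⟩, hd⟩ := h
  have hσ : ∀ x, τ x ≠ x → σ x = x := fun x hx => by
    by_contra h
    exact Set.disjoint_left.1 hd h hx
  have hτ : ∀ x, σ x ≠ x → τ x = x := fun x hx => by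
    by_contra h
    exact Set.disjoint_left.1 hd hx h
  let p : Matrix (Fin 2) (Fin 2) ℂ := !![1, 0; 0, 0]
  let q : Matrix (Fin 2) (Fin 2) ℂ := !![1 / 2, 1 / 2; 1 / 2, 1 / 2]
  -- With `ρ = τ ∘ σ`, the projection `q` governs the action of `τ` on its support and `p` that of
  -- `σ` on the rest. A vertex on one side is fixed by the automorphism acting on the other, which
  -- gives `hadj`.
  let e : V → Matrix (Fin 2) (Fin 2) ℂ := fun x => if τ x = x then p else q
  have hp : star p = p := by
    ext i j
    fin_cases i <;> fin_cases j <;> simp [p, Matrix.star_apply]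
  have hq : star q = q := by
    ext i j
    fin_cases i <;> fin_cases j <;> simp [q, Matrix.star_apply]
  have hpp : p * p = p := by
    simp only [p, Matrix.mul_fin_two]
    norm_num
  have hqq : q * q = q := by
    simp only [q, Matrix.mul_fin_two]
    norm_num
  have hpq : p * q ≠ q * p := by
    intro h
    have := congrFun (congrFun h 0) 1
    simp [p, q] at this
  let ρ : G ≃g G := σ.trans τ
  have hρ1 : ∀ x, τ x ≠ x → ρ x = τ x := fun x hx => congrArg τ (hσ x hx)
  have hρ2 : ∀ x, τ x = x → ρ x = σ x := by
    intro x hx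
    change τ (σ x) = σ x
    by_cases h : σ x = x
    · rw [h, hx]
    · exact hτ _ fun h' => h (σ.injective h')
  have hτρ : ∀ x, τ (ρ x) = ρ x ↔ τ x = x := by
    intro x
    by_cases hx : τ x = x
    · simp only [hx, iff_true]
      rw [hρ2 x hx]
      exact hρ2 x hx
    · rw [hρ1 x hx]
      exact τ.injective.eq_iff
  have hρe : ∀ x, e (ρ x) = e x := fun x => by simp only [e, hτρ]
  have hadj : ∀ x z, e x ≠ e z → (G.Adj x (ρ z) ↔ G.Adj x z) := by
    intro x z hxz
    by_cases hx : τ x = x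
    · have hz : τ z ≠ z := fun hz => hxz (by simp [e, hx, hz])
      rw [hρ1 z hz]
      conv_lhs => rw [← hx]
      exact τ.map_adj_iff
    · have hz : τ z = z := by
        by_contra hz
        exact hxz (by simp [e, hx, hz])
      rw [hρ2 z hz]
      conv_lhs => rw [← hσ x hx]
      exact σ.map_adj_iff
  obtain ⟨φ, hφ, -⟩ := QuantumAut.existsUnique_lift G (twoValuedMatrix ρ.toEquiv e)
    (isMagicUnitary_twoValuedMatrix ρ.toEquiv
      (fun x => by simp only [e]; split_ifs <;> assumption)
      (fun x => by simp only [e]; split_ifs <;> assumption) hρe)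
    (intertwines_twoValuedMatrix ρ hρe hadj)
  intro hcomm
  have h1 : φ (QuantumAut.U G v v) = p := by
    have h' : τ v = v := hτ v hv
    have : v ≠ ρ v := by
      rw [hρ2 v h']
      exact hv.symm
    rw [hφ]
    simp only [twoValuedMatrix, if_true]
    rw [if_neg (by exact this), add_zero]
    exact if_pos h'
  have h2 : φ (QuantumAut.U G w w) = q := by
    have : w ≠ ρ w := by
      rw [hρ1 w hw]
      exact hw.symm
    rw [hφ]
    simp only [twoValuedMatrix, if_true]
    rw [if_neg (by exact this), add_zero]
    exact if_neg hw
  refine hpq ?_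
  rw [← h1, ← h2, ← map_mul, ← map_mul, hcomm]

theorem mainTheorem1 {V : Type u} [Fintype V] (G : SimpleGraph V) (hG : G.IsBlockGraph) :
    (∀ S : Set V, (G.induce S).IsBlockGraph) ∧
    (∀ (W : Type v) [Fintype W] (H : SimpleGraph W),
      QuantumIsomorphic.{u, v, w} G H → Nonempty (H ≃g G)) ∧
    (HasQuantumSymmetry G ↔ G.SchmidtCriterion) :=
  ⟨hG.induce, fun _ _ _ h => h.nonempty_iso hG,
    fun h => h.schmidtCriterion hG, fun h => h.hasQuantumSymmetry⟩
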